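/- **Theorem 1.2.** For a meromorphic function $g$ on $\mathbb{C}$ let $m(r,g)$, $N(r,g)$ and $T(r,g)=m(r,g)+N(r,g)$ be the Nevanlinna proximity function, integrated counting function of poles and characteristic, let $n(r,g)$ be the number of poles of $g$ in $|z|\le r$ counted with multiplicity, and for $w\in\mathbb{C}\setminus\{0\}$ and $\epsilon>0$ let $$R_{\epsilon,w}(r,g)=\frac{n_{\angle\epsilon,w}(r,g)}{n(r,g)},$$ where $n_{\angle\epsilon,w}(r,g)$ counts, with multiplicity, the poles $z_0$ of $g$ with $|z_0|<r$ and $\left|\sin\left(\arg\frac{z_0}{w}\right)\right|\ge 1-\sqrt{\epsilon}$ (and $R_{\epsilon,w}(r,g)=0$ if $n(r,g)=0$). A set $E\subset(0,\infty)$ has finite logarithmic measure if $\int_E\frac{dt}{t}<\infty$. Let $f$ be a non-constant meromorphic function on $\mathbb{C}$ of hyper-order $$\varsigma=\limsup_{r\to\infty}\frac{\log^+\log^+ T(r,f)}{\log r}<\frac34,$$ let $0<\beta<\min\left\{\frac12-\frac12\varsigma,\;1-\frac43\varsigma\right\}$, let $\omega:(0,\infty)\to\mathbb{C}$ satisfy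 $0<|\omega(r)|<r^\beta$ for all $r>0$, and let $a\in\mathbb{C}$ be such that $f'\not\equiv a$. For each $r>0$ write $\omega=\omega(r)$ and $\Delta_\omega f(z)=f(z+\omega)-f(z)$. Then for every sufficiently small $\epsilon>0$ there is a set $E=E(\epsilon,a,\beta,\omega,f)$ of finite logarithmic measure such that, as $r\to\infty$ outside $E$, $$ \begin{aligned} m\left(r,\frac{\Delta_\omega f-a\omega}{f'-a}\right) ={}&O\left(\frac{T(r,f')}{r^{1-\varsigma-2\beta-\epsilon}}\right) +O\Bigg(R_{\epsilon,\omega}\left(r,\frac1{f'-a}\right)\frac{N\left(r,\frac1{f'-a}\right)}{r^{\frac32-2\varsigma-\frac32\beta-\epsilon}}\\ &+R_{\epsilon,\omega}(r,f')\,\frac{N(r,f')}{r^{\frac32-2\varsigma-\frac32\beta-\epsilon}}\Bigg)+O(\log r). \end{aligned} $$ If moreover $f$ is transcendental (not a rational function), then with the same set $E$ we have $$m\left(r,\frac{\Delta_\omega f-a\omega}{f'-a}\right)=o(T(r,f'))$$ as $r\to\infty$ outside $E$; that is, the left side is $S(r,f')$. -/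

import Mathlib

open Filter Set MeasureTheory

noncomputable section

namespace VarShift

/-- Two meromorphic functions on the plane are identified when they agree off a closed discrete
set.  `IsConst f` says that `f` is a constant meromorphic function. -/
def IsConst (f : ℂ → ℂ) : Prop :=
  ∃ c : ℂ, f =ᶠ[codiscrete ℂ] fun _ => c

/-- `f` is a transcendental function: it is not a rational function. -/
def IsTranscendental (f : ℂ → ℂ) : Prop :=
  ¬ ∃ p q : Polynomial ℂ, q ≠ 0 ∧ f =ᶠ[codiscrete ℂ] fun z => p.eval z / q.eval z

/-- The proximity function `m(r, g)` at infinity. -/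
abbrev m (r : ℝ) (g : ℂ → ℂ) : ℝ := ValueDistribution.proximity g ⊤ r

/-- The integrated counting function `N(r, g)` of the poles of `g`, with multiplicity. -/
abbrev N (r : ℝ) (g : ℂ → ℂ) : ℝ := ValueDistribution.logCounting g ⊤ r

/-- The Nevanlinna characteristic `T(r, g) = m(r, g) + N(r, g)`. -/
abbrev T (r : ℝ) (g : ℂ → ℂ) : ℝ := ValueDistribution.characteristic g ⊤ r

/-- The hyper-order `limsup_{r → ∞} log log T(r, f) / log r`. -/
def hyperOrder (f : ℂ → ℂ) : EReal :=
  limsup (fun r : ℝ =>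
    ((Real.posLog (Real.posLog (T r f)) / Real.log r : ℝ) : EReal)) atTop

/-- The multiplicity of `z` as a pole of `g` (zero if `z` is not a pole). -/
def poleMult (g : ℂ → ℂ) (z : ℂ) : ℤ :=
  (MeromorphicOn.divisor g (univ : Set ℂ))⁻ z

/-- The counting function `n(r, g)`: the number of poles of `g` in `|z| ≤ r`, with
multiplicity. -/
def n (r : ℝ) (g : ℂ → ℂ) : ℝ :=
  ∑ᶠ z ∈ {z : ℂ | ‖z‖ ≤ r}, (poleMult g z : ℝ)

/-- The angular counting function: the number, with multiplicity, of the poles `z₀` of `g` with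
`|z₀| < r` and `|sin (arg (z₀ / w))| ≥ 1 - √ε`. -/
def nAngle (ε : ℝ) (w : ℂ) (r : ℝ) (g : ℂ → ℂ) : ℝ :=
  ∑ᶠ z ∈ {z : ℂ | ‖z‖ < r ∧ 1 - √ε ≤ |Real.sin (Complex.arg (z / w))|}, (poleMult g z : ℝ)

/-- The ratio `R_{ε,w}(r, g)` of the angular counting function and the counting function.  If `g`
has no poles in `|z| ≤ r`, it is `0` (it is then only used as a factor of `N(r, g) = 0`). -/
def angularRatio (ε : ℝ) (w : ℂ) (r : ℝ) (g : ℂ → ℂ) : ℝ :=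
  nAngle ε w r g / n r g

/-- A set of positive real numbers of finite logarithmic measure. -/
def FiniteLogMeasure (E : Set ℝ) : Prop :=
  E ⊆ Ioi 0 ∧ MeasurableSet E ∧ ∫⁻ t in E, ENNReal.ofReal (1 / t) < ⊤

/-- The filter `r → ∞` outside the set `E`. -/
def atTopOutside (E : Set ℝ) : Filter ℝ := atTop ⊓ 𝓟 Eᶜ

/-- The quotient `(Δ_w f - a w) / (f' - a)`, where `Δ_w f (z) = f (z + w) - f z`. -/
def shiftQuotient (f : ℂ → ℂ) (a w : ℂ) : ℂ → ℂ :=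
  fun z => (f (z + w) - f z - a * w) / (deriv f z - a)

end VarShift

end

section

open Topology Metric MeromorphicOn
open scoped ComplexConjugate

noncomputable section

namespace Nevanlinna

/-! ### Integrals of negative powers -/

/-! Put g = f' - a. Since f(z) - az is a primitive of g, the numerator of the shift quotient at z is
the integral of g along any path from z to z + w that avoids the poles of f. So the quotient is at
most the length of the path times max|g|/|g(z)| on it, and everything rests on how far log|g| can
rise along a well-chosen path of length comparable to |w|.

By Poisson–Jensen on |z| < R, log|g| is a harmonic function minus a finite sum of logarithms of
canonical factors (`exists_poissonJensen`). The harmonic part varies by at most |w|/(R - |z|) times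
the Poisson integral of its own modulus (`sub_le_poissonAbs`), whose mean over |z| = r is m(R,g) +
m(R,1/g). Each canonical factor varies by a multiple of |w|^α |z - i|^(-α), with α < 1, plus the
same quantity at the other point. A straight segment may pass too close to some point i, but
averaging over a one-parameter family of two-legged detours yields one on which the whole potential
is controlled by its values at z and z + w (`exists_polygonal_path`). Circle means of |z - i|^(-α)
are O(r^(-α)) uniformly in i. With R near r + h this gives
`exists_proximity_shiftQuotient_le_characteristic`.

Take h = r^(1-σ) with σ slightly above the hyper-order. Since log T(r,f') = O(r^s) for some s < σ
(`exists_logCharacteristic_deriv_le`), T(r+h,f') + 1 ≤ 2(T(r,f') + 1) off a set of finite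
logarithmic measure (`finiteLogMeasure_of_monotone`), and with α near 1 the powers of r combine to
the first term plus O(log r). The angular terms are nonnegative, so they only enlarge the right
side.

For the little-o claim it remains that log r = o(T(r,f')) when f is transcendental
(`eventually_lt_characteristic_deriv`): if T(r,f') ≤ C log r for arbitrarily large r, then f has
finitely many poles and polynomial growth on large circles, so it is rational. -/

lemma log_one_add_le_rpow {α x : ℝ} (hα : 0 < α) (hα' : α ≤ 1) (hx : 0 ≤ x) :
    Real.log (1 + x) ≤ x ^ α / α := by
  rw [le_div_iff₀ hα, mul_comm, ← Real.log_rpow (by positivity)]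
  calc Real.log ((1 + x) ^ α) ≤ Real.log (1 + x ^ α) := by
        apply Real.log_le_log (by positivity)
        simpa using Real.rpow_add_le_add_rpow zero_le_one hx hα.le hα'
    _ ≤ x ^ α := by
        have := Real.log_le_sub_one_of_pos (show 0 < 1 + x ^ α by positivity)
        linarith

lemma intervalIntegrable_abs_rpow {p : ℝ} (hp : -1 < p) (a b : ℝ) :
    IntervalIntegrable (fun x : ℝ ↦ |x| ^ p) volume a b := by
  have pos (b : ℝ) (hb : 0 ≤ b) : IntervalIntegrable (fun x : ℝ ↦ |x| ^ p) volume 0 b := by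
    refine (intervalIntegral.intervalIntegrable_rpow' hp (a := 0) (b := b)).congr fun x hx ↦ ?_
    rw [uIoc_of_le hb] at hx
    simp [abs_of_pos hx.1]
  have all (b : ℝ) : IntervalIntegrable (fun x : ℝ ↦ |x| ^ p) volume 0 b := by
    rcases le_total 0 b with hb | hb
    · exact pos b hb
    · rw [IntervalIntegrable.iff_comp_neg]
      simpa using pos (-b) (by linarith)
  exact (all a).symm.trans (all b)

/-- Two regimes. If |B| > 2|A| the integrand is comparable with the constant |B|^(-α). Otherwise its
zero c = B/A lies in [-2, 2], so the substitution u = s - c leaves an integral of |u|^(-α) over part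
of [-3, 3], which is the `K` below. -/
lemma exists_integral_abs_linear_rpow_le {α : ℝ} (hα : 0 < α) (hα' : α < 1) :
    ∃ C : ℝ, 0 < C ∧ ∀ A B : ℝ, (A ≠ 0 ∨ B ≠ 0) →
      IntervalIntegrable (fun s : ℝ ↦ |B - A * s| ^ (-α)) volume 0 1 ∧
      ∫ s in (0 : ℝ)..1, |B - A * s| ^ (-α) ≤ C * (max |A| |B|) ^ (-α) := by
  set K := ∫ u in (-3 : ℝ)..3, |u| ^ (-α) with hK
  have hK0 : 0 ≤ K := intervalIntegral.integral_nonneg (by norm_num) fun u _ ↦ by positivity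
  refine ⟨2 ^ α * (1 + K), by positivity, fun A B hAB ↦ ?_⟩
  have hmax : 0 < max |A| |B| := by
    rcases hAB with h | h
    · exact lt_max_of_lt_left (abs_pos.2 h)
    · exact lt_max_of_lt_right (abs_pos.2 h)
  have two_pow : (2 : ℝ) ^ α = (1 / 2 : ℝ) ^ (-α) := by
    rw [Real.rpow_neg (by norm_num), ← Real.inv_rpow (by norm_num)]; norm_num
  have hint : IntervalIntegrable (fun s : ℝ ↦ |B - A * s| ^ (-α)) volume 0 1 := by
    by_cases hA : A = 0
    · simp [hA]
    · have h := ((intervalIntegrable_abs_rpow (p := -α) (by linarith)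
        (0 - B / A) (1 - B / A)).comp_sub_right (B / A)).const_mul (|A| ^ (-α))
      simp only [sub_add_cancel] at h
      refine h.congr fun s _ ↦ ?_
      rw [← Real.mul_rpow (abs_nonneg _) (abs_nonneg _), ← abs_mul, ← abs_neg]
      congr 2
      field_simp
      ring
  refine ⟨hint, ?_⟩
  by_cases hcase : 2 * |A| < |B|
  · have h1 : ∀ s ∈ Icc (0 : ℝ) 1, |B - A * s| ^ (-α) ≤ (1 / 2 * |B|) ^ (-α) := by
      intro s hs
      apply Real.rpow_le_rpow_of_nonpos (by linarith [abs_nonneg A]) _ (by linarith)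
      have h2 : |A * s| ≤ |A| := by
        rw [abs_mul, abs_of_nonneg hs.1]
        exact mul_le_of_le_one_right (abs_nonneg _) hs.2
      have := abs_sub_abs_le_abs_sub B (A * s)
      linarith
    calc ∫ s in (0 : ℝ)..1, |B - A * s| ^ (-α)
        ≤ ∫ s in (0 : ℝ)..1, (1 / 2 * |B|) ^ (-α) :=
          intervalIntegral.integral_mono_on (by norm_num) hint (by simp) h1
      _ = 2 ^ α * |B| ^ (-α) := by
          rw [intervalIntegral.integral_const, Real.mul_rpow (by norm_num) (abs_nonneg _), two_pow]
          simp
      _ ≤ 2 ^ α * (1 + K) * (max |A| |B|) ^ (-α) := by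
          rw [max_eq_right (by linarith [abs_nonneg A])]
          gcongr
          have : (0 : ℝ) < 2 ^ α := by positivity
          nlinarith
  · rw [not_lt] at hcase
    have hA : A ≠ 0 := by
      rintro rfl
      simp at hcase
      simp [hcase] at hAB
    have hA' : 0 < |A| := abs_pos.2 hA
    set c := B / A with hc
    have hc2 : |c| ≤ 2 := by
      rw [hc, abs_div, div_le_iff₀ hA']; linarith
    obtain ⟨hc3, hc4⟩ := abs_le.1 hc2
    have heq : ∀ s : ℝ, |B - A * s| ^ (-α) = |A| ^ (-α) * |s - c| ^ (-α) := by
      intro s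
      rw [← Real.mul_rpow (abs_nonneg _) (abs_nonneg _), ← abs_mul, ← abs_neg]
      congr 2
      rw [hc]; field_simp
      ring
    simp_rw [heq]
    rw [intervalIntegral.integral_const_mul,
      intervalIntegral.integral_comp_sub_right (fun u ↦ |u| ^ (-α)) c]
    have h1 : ∫ u in (0 - c)..(1 - c), |u| ^ (-α) ≤ K :=
      intervalIntegral.integral_mono_interval (by linarith) (by linarith) (by linarith)
        (ae_of_all _ fun u ↦ by positivity) (intervalIntegrable_abs_rpow (by linarith) _ _)
    have h2 : |A| ^ (-α) ≤ 2 ^ α * (max |A| |B|) ^ (-α) := by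
      rw [two_pow, ← Real.mul_rpow (by norm_num) hmax.le]
      apply Real.rpow_le_rpow_of_nonpos (by positivity) _ (by linarith)
      have : max |A| |B| ≤ 2 * |A| := max_le (by linarith) hcase
      linarith
    calc |A| ^ (-α) * ∫ u in (0 - c)..(1 - c), |u| ^ (-α)
        ≤ (2 ^ α * (max |A| |B|) ^ (-α)) * (1 + K) := by
          apply mul_le_mul h2 (by linarith) _ (by positivity)
          exact intervalIntegral.integral_nonneg (by linarith) fun u _ ↦ by positivity
      _ = _ := by ring

/-! ### Two-legged detours from z to z + w -/

/-- Up to a factor, the distance of `ζ` to the line through `0` and `1 / 2 + s * I`. -/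
def lineDist (ζ : ℂ) (s : ℝ) : ℝ := |ζ.im / 2 - ζ.re * s|

lemma lineDist_nonneg (ζ : ℂ) (s : ℝ) : 0 ≤ lineDist ζ s := abs_nonneg _

/-- Multiplying by `conj v` makes `τ * v` real, so the imaginary part no longer sees τ. -/
lemma lineDist_le (ζ : ℂ) {s : ℝ} (hs : s ∈ Icc (0 : ℝ) 1) (τ : ℝ) :
    lineDist ζ s ≤ 2 * ‖(τ : ℂ) * (1 / 2 + s * Complex.I) - ζ‖ := by
  set v : ℂ := 1 / 2 + s * Complex.I with hv
  have h1 : lineDist ζ s = |(conj v * (τ * v - ζ)).im| := by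
    rw [lineDist, ← abs_neg]
    congr 1
    simp [hv, Complex.mul_im, Complex.mul_re]
    ring
  have h2 : ‖v‖ ≤ 2 := by
    calc ‖v‖ ≤ ‖(1 / 2 : ℂ)‖ + ‖(s : ℂ) * Complex.I‖ := norm_add_le _ _
      _ ≤ 1 / 2 + 1 := by
        gcongr
        · simp
        · simpa [abs_of_nonneg hs.1] using hs.2
      _ ≤ 2 := by norm_num
  rw [h1]
  calc |(conj v * (τ * v - ζ)).im| ≤ ‖conj v * (τ * v - ζ)‖ := Complex.abs_im_le_norm _
    _ = ‖v‖ * ‖τ * v - ζ‖ := by simp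
    _ ≤ 2 * ‖τ * v - ζ‖ := by gcongr

lemma finite_lineDist_eq_zero {ζ : ℂ} (hζ : ζ ≠ 0) : {s : ℝ | lineDist ζ s = 0}.Finite := by
  apply Set.Subsingleton.finite
  intro s hs t ht
  simp only [lineDist, mem_ofPred_eq, abs_eq_zero] at hs ht
  by_contra hst
  have h1 : ζ.re * (s - t) = 0 := by linarith
  have h2 : ζ.re = 0 := by
    rcases mul_eq_zero.1 h1 with h | h
    · exact h
    · exact absurd (sub_eq_zero.1 h) hst
  apply hζ
  apply Complex.ext
  · simpa using h2
  · simp only [h2, zero_mul, sub_zero] at hs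
    simp; linarith

lemma exists_integral_lineDist_rpow_le {α : ℝ} (hα : 0 < α) (hα' : α < 1) :
    ∃ C : ℝ, 0 < C ∧ ∀ ζ : ℂ, ζ ≠ 0 →
      IntervalIntegrable (fun s : ℝ ↦ lineDist ζ s ^ (-α)) volume 0 1 ∧
      ∫ s in (0 : ℝ)..1, lineDist ζ s ^ (-α) ≤ C * ‖ζ‖ ^ (-α) := by
  obtain ⟨C, hC, h⟩ := exists_integral_abs_linear_rpow_le hα hα'
  refine ⟨C * (1 / 3) ^ (-α), by positivity, fun ζ hζ ↦ ?_⟩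
  obtain ⟨h1, h2⟩ := h ζ.re (ζ.im / 2) (by
    by_contra! hcon
    exact hζ (Complex.ext (by simpa using hcon.1) (by have := hcon.2; simp; linarith)))
  refine ⟨h1, h2.trans ?_⟩
  rw [mul_assoc, ← Real.mul_rpow (by norm_num) (norm_nonneg _)]
  gcongr 1
  apply Real.rpow_le_rpow_of_nonpos (by positivity) _ (by linarith)
  have h3 := Complex.norm_le_abs_re_add_abs_im ζ
  have h4 := le_max_left |ζ.re| |ζ.im / 2|
  have h5 := le_max_right |ζ.re| |ζ.im / 2|
  have h6 : |ζ.im / 2| = |ζ.im| / 2 := by rw [abs_div]; norm_num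
  linarith

/-- The corner is q = z + wv with v = 1/2 + is and s in [0, 1]. The distance from a leg to a point i
is bounded below by |w| times the distance of the normalised point to a line through 0, and the
(-α)-th power of the latter is integrable in s. Hence the mean over s of the potential on the detour
is controlled by the potential at the two endpoints, and some s does no worse than the mean. -/
lemma exists_polygonal_path {α : ℝ} (hα : 0 < α) (hα' : α < 1) :
    ∃ C : ℝ, 0 < C ∧ ∀ (S : Finset ℂ) (k : ℂ → ℝ), (∀ i, 0 ≤ k i) → ∀ z w : ℂ, w ≠ 0 →
      z ∉ S → z + w ∉ S → ∃ q : ℂ, ‖q - z‖ ≤ 2 * ‖w‖ ∧ ‖q - (z + w)‖ ≤ 2 * ‖w‖ ∧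
        ∀ z' ∈ segment ℝ z q ∪ segment ℝ (z + w) q, z' ∉ S ∧
          ∑ i ∈ S, k i * ‖z' - i‖ ^ (-α) ≤
            C * ∑ i ∈ S, k i * (‖z - i‖ ^ (-α) + ‖z + w - i‖ ^ (-α)) := by
  obtain ⟨C, hC, hJ⟩ := exists_integral_lineDist_rpow_le hα hα'
  refine ⟨(1 / 2) ^ (-α) * C, by positivity, fun S k hk z w hw hzS hzwS ↦ ?_⟩
  have hw' : 0 < ‖w‖ := norm_pos_iff.2 hw
  set ζ : ℂ → ℂ := fun i ↦ (i - z) / w with hζ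
  -- Since v - 1 = -conj v, the reflection ζ ↦ -conj ζ carries the leg issuing from z + w onto a
  -- line through 0 and v, so both legs are measured by the same `lineDist`.
  set ξ : ℂ → ℂ := fun i ↦ -conj ((i - (z + w)) / w) with hξ
  have hζ0 : ∀ i ∈ S, ζ i ≠ 0 := fun i hi ↦
    div_ne_zero (sub_ne_zero.2 (by rintro rfl; exact hzS hi)) hw
  have hξ0 : ∀ i ∈ S, ξ i ≠ 0 := fun i hi ↦ by
    simp only [hξ, ne_eq, neg_eq_zero, map_eq_zero]
    exact div_ne_zero (sub_ne_zero.2 (by rintro rfl; exact hzwS hi)) hw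
  have hζn : ∀ i, ‖ζ i‖ = ‖z - i‖ / ‖w‖ := fun i ↦ by simp [hζ, norm_sub_rev]
  have hξn : ∀ i, ‖ξ i‖ = ‖z + w - i‖ / ‖w‖ := fun i ↦ by
    simp only [hξ, norm_neg, RCLike.norm_conj, norm_div]; rw [norm_sub_rev]
  set H : ℝ → ℝ := fun s ↦ ∑ i ∈ S, k i * (lineDist (ζ i) s ^ (-α) + lineDist (ξ i) s ^ (-α))
    with hH
  have hii : ∀ i ∈ S, IntervalIntegrable
      (fun s ↦ k i * (lineDist (ζ i) s ^ (-α) + lineDist (ξ i) s ^ (-α))) volume 0 1 :=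
    fun i hi ↦ (((hJ _ (hζ0 i hi)).1.add (hJ _ (hξ0 i hi)).1).const_mul _)
  have hHint : IntervalIntegrable H volume 0 1 := by
    have e : H = ∑ i ∈ S, fun s ↦ k i * (lineDist (ζ i) s ^ (-α) + lineDist (ξ i) s ^ (-α)) := by
      funext s; simp [hH]
    rw [e]
    exact IntervalIntegrable.sum S hii
  have hHle : ∫ s in (0 : ℝ)..1, H s ≤
      C * ‖w‖ ^ α * ∑ i ∈ S, k i * (‖z - i‖ ^ (-α) + ‖z + w - i‖ ^ (-α)) := by
    rw [hH, intervalIntegral.integral_finsetSum hii, Finset.mul_sum]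
    refine Finset.sum_le_sum fun i hi ↦ ?_
    rw [intervalIntegral.integral_const_mul,
      intervalIntegral.integral_add (hJ _ (hζ0 i hi)).1 (hJ _ (hξ0 i hi)).1]
    have e1 := (hJ _ (hζ0 i hi)).2
    have e2 := (hJ _ (hξ0 i hi)).2
    have aux : ∀ x : ℝ, 0 ≤ x → (x / ‖w‖) ^ (-α) = ‖w‖ ^ α * x ^ (-α) := fun x hx ↦ by
      rw [Real.div_rpow hx hw'.le, Real.rpow_neg hw'.le, div_inv_eq_mul, mul_comm]
    rw [hζn, aux _ (norm_nonneg _)] at e1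
    rw [hξn, aux _ (norm_nonneg _)] at e2
    calc _ ≤ k i * (C * (‖w‖ ^ α * ‖z - i‖ ^ (-α)) + C * (‖w‖ ^ α * ‖z + w - i‖ ^ (-α))) :=
          mul_le_mul_of_nonneg_left (add_le_add e1 e2) (hk i)
      _ = _ := by ring
  set bad : Set ℝ := ⋃ i ∈ S, ({s | lineDist (ζ i) s = 0} ∪ {s | lineDist (ξ i) s = 0}) with hbad
  have hbadfin : bad.Finite := S.finite_toSet.biUnion fun i hi ↦
    (finite_lineDist_eq_zero (hζ0 i hi)).union (finite_lineDist_eq_zero (hξ0 i hi))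
  -- First-moment choice of s. The finitely many s for which a leg could meet S form a null set and
  -- are avoided at the same time.
  obtain ⟨s, hsbad, hs⟩ : ∃ s ∉ bad ∪ (Icc 0 1)ᶜ, H s ≤ ∫ s in (0 : ℝ)..1, H s := by
    have hp : IsProbabilityMeasure (volume.restrict (Ioc (0 : ℝ) 1)) :=
      ⟨by simp⟩
    have := exists_notMem_null_le_integral (μ := volume.restrict (Ioc (0 : ℝ) 1)) (f := H)
      (N := bad ∪ (Icc 0 1)ᶜ) ((intervalIntegrable_iff_integrableOn_Ioc_of_le zero_le_one).1 hHint)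
      (by
        apply measure_union_null (hbadfin.measure_zero _)
        rw [Measure.restrict_apply measurableSet_Icc.compl]
        convert measure_empty (μ := volume)
        ext x; simp; intro h h1; exact h h1.le)
    rwa [← intervalIntegral.integral_of_le zero_le_one] at this
  have hs01 : s ∈ Icc (0 : ℝ) 1 := by by_contra h; exact hsbad (Or.inr h)
  have hpos : ∀ i ∈ S, 0 < lineDist (ζ i) s ∧ 0 < lineDist (ξ i) s := fun i hi ↦ by
    have : s ∉ bad := fun h ↦ hsbad (Or.inl h)
    simp only [hbad, mem_iUnion, not_exists, mem_union, mem_ofPred_eq, not_or] at this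
    exact ⟨lt_of_le_of_ne (lineDist_nonneg _ _) (Ne.symm (this i hi).1),
      lt_of_le_of_ne (lineDist_nonneg _ _) (Ne.symm (this i hi).2)⟩
  set v : ℂ := 1 / 2 + s * Complex.I with hv
  have hvn : ‖v‖ ≤ 2 := by
    calc ‖v‖ ≤ ‖(1 / 2 : ℂ)‖ + ‖(s : ℂ) * Complex.I‖ := norm_add_le _ _
      _ ≤ 1 / 2 + 1 := by
        gcongr
        · simp
        · simpa [abs_of_nonneg hs01.1] using hs01.2
      _ ≤ 2 := by norm_num
  have hv' : v - 1 = -conj v := by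
    apply Complex.ext <;> simp [hv]; norm_num
  have key : ∀ z' ∈ segment ℝ z (z + w * v) ∪ segment ℝ (z + w) (z + w * v), ∀ i ∈ S,
      0 < ‖z' - i‖ ∧ ‖z' - i‖ ^ (-α) ≤
        (‖w‖ / 2) ^ (-α) * (lineDist (ζ i) s ^ (-α) + lineDist (ξ i) s ^ (-α)) := by
    intro z' hz' i hi
    obtain ⟨p1, p2⟩ := hpos i hi
    have fin : ∀ d, 0 < d → ‖w‖ / 2 * d ≤ ‖z' - i‖ →
        0 < ‖z' - i‖ ∧ ‖z' - i‖ ^ (-α) ≤ (‖w‖ / 2) ^ (-α) * d ^ (-α) := fun d hd h ↦ by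
      refine ⟨lt_of_lt_of_le (by positivity) h, ?_⟩
      rw [← Real.mul_rpow (by positivity) hd.le]
      exact Real.rpow_le_rpow_of_nonpos (by positivity) h (by linarith)
    rcases hz' with hz' | hz'
    · rw [segment_eq_image'] at hz'
      obtain ⟨τ, -, rfl⟩ := hz'
      have := lineDist_le (ζ i) hs01 τ
      obtain ⟨q1, q2⟩ := fin _ p1 (by
        have e : z + τ • (z + w * v - z) - i = w * (τ * v - ζ i) := by
          simp only [hζ, Complex.real_smul]; field_simp; ring
        simp only at e ⊢
        rw [e, norm_mul]
        nlinarith)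
      refine ⟨q1, q2.trans ?_⟩
      gcongr
      exact le_add_of_nonneg_right (by positivity)
    · rw [segment_eq_image'] at hz'
      obtain ⟨τ, -, rfl⟩ := hz'
      have := lineDist_le (ξ i) hs01 τ
      obtain ⟨q1, q2⟩ := fin _ p2 (by
        have e : z + w + τ • (z + w * v - (z + w)) - i = w * -conj (τ * v - ξ i) := by
          have : z + w * v - (z + w) = w * -conj v := by rw [← hv']; ring
          rw [this]
          simp only [hξ, Complex.real_smul, map_sub, map_neg, map_mul, Complex.conj_ofReal,
            Complex.conj_conj]
          field_simp; ring
        simp only at e ⊢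
        rw [e, norm_mul, norm_neg, RCLike.norm_conj]
        nlinarith)
      refine ⟨q1, q2.trans ?_⟩
      gcongr
      exact le_add_of_nonneg_left (by positivity)
  refine ⟨z + w * v, ?_, ?_, fun z' hz' ↦ ⟨fun h ↦ ?_, ?_⟩⟩
  · rw [add_sub_cancel_left, norm_mul]; nlinarith
  · have : z + w * v - (z + w) = w * -conj v := by rw [← hv']; ring
    rw [this, norm_mul, norm_neg, RCLike.norm_conj]; nlinarith
  · simpa using (key z' hz' z' h).1
  · calc ∑ i ∈ S, k i * ‖z' - i‖ ^ (-α) ≤ ∑ i ∈ S, k i * ((‖w‖ / 2) ^ (-α) *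
            (lineDist (ζ i) s ^ (-α) + lineDist (ξ i) s ^ (-α))) :=
          Finset.sum_le_sum fun i hi ↦ mul_le_mul_of_nonneg_left (key z' hz' i hi).2 (hk i)
      _ = (‖w‖ / 2) ^ (-α) * H s := by
          rw [hH, Finset.mul_sum]
          exact Finset.sum_congr rfl fun i _ ↦ by ring
      _ ≤ (‖w‖ / 2) ^ (-α) * (C * ‖w‖ ^ α *
            ∑ i ∈ S, k i * (‖z - i‖ ^ (-α) + ‖z + w - i‖ ^ (-α))) := by
          gcongr
          exact hs.trans hHle
      _ = _ := by
          -- The factors |w|^(-α) and |w|^α cancel: the estimate is scale invariant, so C does not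
          -- depend on w.
          rw [div_eq_mul_one_div, Real.mul_rpow hw'.le (by norm_num), Real.rpow_neg hw'.le]
          have : (‖w‖ ^ α) ≠ 0 := by positivity
          field_simp

/-! ### Circle averages of negative powers of the distance to a point -/

/-- For |θ| ≤ π/2 the imaginary part suffices, by Jordan's inequality; beyond that cos θ ≤ 0, so the
distance to a point of the nonnegative real axis is at least r. -/
lemma mul_abs_div_pi_le_norm_circleMap_sub {r ρ θ : ℝ} (hr : 0 ≤ r) (hρ : 0 ≤ ρ)
    (hθ : |θ| ≤ Real.pi) :
    r * (|θ| / Real.pi) ≤ ‖circleMap 0 r θ - ρ‖ := by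
  have hπ := Real.pi_pos
  have e : circleMap 0 r θ = (r * Real.cos θ : ℝ) + (r * Real.sin θ : ℝ) * Complex.I := by
    simp [circleMap, Complex.exp_mul_I]; ring
  have hre' : (circleMap 0 r θ - ρ).re = r * Real.cos θ - ρ := by
    rw [e, Complex.sub_re, Complex.add_re, Complex.re_ofReal_mul]; simp [Complex.cos_ofReal_re]
  have him' : (circleMap 0 r θ - ρ).im = r * Real.sin θ := by
    rw [e, Complex.sub_im, Complex.add_im, Complex.im_ofReal_mul]; simp
  have him : r * |Real.sin θ| ≤ ‖circleMap 0 r θ - ρ‖ := by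
    refine le_trans (le_of_eq ?_) (Complex.abs_im_le_norm _)
    rw [him', abs_mul, abs_of_nonneg hr]
  rcases le_total |θ| (Real.pi / 2) with h | h
  · have := Real.mul_abs_le_abs_sin h
    refine le_trans ?_ him
    gcongr
    refine le_trans ?_ this
    rw [div_mul_eq_mul_div]
    gcongr
    linarith [abs_nonneg θ]
  · have hcos : Real.cos θ ≤ 0 := by
      rw [← Real.cos_abs]
      exact Real.cos_nonpos_of_pi_div_two_le_of_le h (by linarith)
    have h1 : r ≤ ‖circleMap 0 r θ - ρ‖ := by
      rw [← sq_le_sq₀ hr (norm_nonneg _), ← Complex.normSq_eq_norm_sq, Complex.normSq_apply,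
        hre', him']
      have := Real.sin_sq_add_cos_sq θ
      have h3 : 0 ≤ r * ρ * (-Real.cos θ) := by
        apply mul_nonneg (by positivity); linarith
      nlinarith [sq_nonneg ρ]
    refine le_trans ?_ h1
    exact mul_le_of_le_one_right hr ((div_le_one hπ).2 hθ)

/-- A rotation puts b on the nonnegative real axis, where the chord bound dominates the integrand by
a multiple of |θ|^(-α) independent of |b|. The uniformity in b, including points on the circle
itself, is what the later averaging needs. -/
lemma exists_circleAverage_norm_sub_rpow_le {α : ℝ} (hα : 0 < α) (hα' : α < 1) :
    ∃ C : ℝ, 0 < C ∧ ∀ r : ℝ, 0 < r → ∀ b : ℂ,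
      CircleIntegrable (fun z ↦ ‖z - b‖ ^ (-α)) 0 r ∧
      Real.circleAverage (fun z ↦ ‖z - b‖ ^ (-α)) 0 r ≤ C * r ^ (-α) := by
  have hπ := Real.pi_pos
  set K := ∫ θ in (-Real.pi)..Real.pi, |θ| ^ (-α) with hK
  have hK0 : 0 ≤ K := intervalIntegral.integral_nonneg (by linarith) fun u _ ↦ by positivity
  refine ⟨(2 * Real.pi)⁻¹ * ((1 / Real.pi) ^ (-α) * (1 + K)), by positivity, fun r hr b ↦ ?_⟩
  set F : ℝ → ℝ := fun θ ↦ ‖circleMap 0 r θ - b‖ ^ (-α) with hF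
  have hper : Function.Periodic F (2 * Real.pi) := fun θ ↦ by
    simp [hF, periodic_circleMap 0 r θ]
  set φ := Complex.arg b with hφ
  have hb : b = ‖b‖ * Complex.exp (φ * Complex.I) := (Complex.norm_mul_exp_arg_mul_I b).symm
  have hshift : ∀ θ : ℝ, ‖circleMap 0 r (θ + φ) - b‖ = ‖circleMap 0 r θ - ‖b‖‖ := by
    intro θ
    have : circleMap 0 r (θ + φ) - b =
        (circleMap 0 r θ - ‖b‖) * Complex.exp (φ * Complex.I) := by
      conv_lhs => rw [hb]
      simp only [circleMap, zero_add, Complex.ofReal_add, add_mul, Complex.exp_add]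
      ring
    rw [this, norm_mul, Complex.norm_exp_ofReal_mul_I, mul_one]
  have hbound : ∀ θ ∈ uIoc (-Real.pi) Real.pi, θ ≠ 0 →
      F (θ + φ) ≤ (r * (1 / Real.pi)) ^ (-α) * |θ| ^ (-α) := by
    intro θ hθ hθ0
    rw [uIoc_of_le (by linarith)] at hθ
    rw [← Real.mul_rpow (by positivity) (abs_nonneg _), hF]
    simp only
    rw [hshift]
    have hθ1 : 0 < |θ| := abs_pos.2 hθ0
    apply Real.rpow_le_rpow_of_nonpos (by positivity) _ (by linarith)
    have := mul_abs_div_pi_le_norm_circleMap_sub hr.le (norm_nonneg b) (abs_le.2 ⟨hθ.1.le, hθ.2⟩)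
    refine le_trans (le_of_eq ?_) this
    ring
  have hmeas : Measurable fun θ ↦ F (θ + φ) := by
    have hc : Continuous fun θ : ℝ ↦ ‖circleMap 0 r (θ + φ) - b‖ := by fun_prop
    exact hc.measurable.pow_const _
  have hae : ∀ᵐ θ : ℝ, θ ∈ uIoc (-Real.pi) Real.pi →
      F (θ + φ) ≤ (r * (1 / Real.pi)) ^ (-α) * |θ| ^ (-α) := by
    filter_upwards [compl_mem_ae_iff.2 (measure_singleton (0 : ℝ))] with θ hθ hθ'
    exact hbound θ hθ' hθ
  have hdom : IntervalIntegrable (fun θ : ℝ ↦ (r * (1 / Real.pi)) ^ (-α) * |θ| ^ (-α)) volume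
      (-Real.pi) Real.pi := (intervalIntegrable_abs_rpow (by linarith) _ _).const_mul _
  have hint1 : IntervalIntegrable (fun θ ↦ F (θ + φ)) volume (-Real.pi) Real.pi := by
    refine hdom.mono_fun' hmeas.aestronglyMeasurable ?_
    rw [EventuallyLE, ae_restrict_iff' measurableSet_uIoc]
    filter_upwards [hae] with θ hθ hθ'
    rw [Real.norm_of_nonneg (by simp only [hF]; positivity)]
    exact hθ hθ'
  have hint2 : IntervalIntegrable F volume (-Real.pi + φ) (-Real.pi + φ + 2 * Real.pi) := by
    have := hint1.comp_sub_right φ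
    simp only [sub_add_cancel] at this
    convert this using 1
    ring
  have hint : CircleIntegrable (fun z ↦ ‖z - b‖ ^ (-α)) 0 r := by
    have := hper.intervalIntegrable (by positivity) hint2 0 (2 * Real.pi)
    exact this
  refine ⟨hint, ?_⟩
  have hval : ∫ θ in (0 : ℝ)..(2 * Real.pi), F θ = ∫ θ in (-Real.pi)..Real.pi, F (θ + φ) := by
    rw [intervalIntegral.integral_comp_add_right F φ]
    have := hper.intervalIntegral_add_eq 0 (-Real.pi + φ)
    rw [zero_add] at this
    rw [this]
    congr 1
    ring
  rw [Real.circleAverage_def, smul_eq_mul, mul_assoc]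
  gcongr
  calc ∫ θ in (0 : ℝ)..(2 * Real.pi), F θ = ∫ θ in (-Real.pi)..Real.pi, F (θ + φ) := hval
    _ ≤ ∫ θ in (-Real.pi)..Real.pi, (r * (1 / Real.pi)) ^ (-α) * |θ| ^ (-α) := by
        apply intervalIntegral.integral_mono_ae_restrict (by linarith) hint1 hdom
        rw [EventuallyLE, ae_restrict_iff' measurableSet_Icc]
        filter_upwards [compl_mem_ae_iff.2 (measure_singleton (-Real.pi)), hae] with θ hθ h2 h3
        apply h2
        rw [uIoc_of_le (by linarith)]
        exact ⟨lt_of_le_of_ne h3.1 (Ne.symm hθ), h3.2⟩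
    _ = r ^ (-α) * ((1 / Real.pi) ^ (-α) * K) := by
        rw [intervalIntegral.integral_const_mul, Real.mul_rpow hr.le (by positivity), mul_assoc]
    _ ≤ r ^ (-α) * ((1 / Real.pi) ^ (-α) * (1 + K)) := by
        gcongr; linarith
    _ = _ := by ring

/-- Circle averages are monotone with respect to inequalities off a discrete set. -/
lemma circleAverage_mono_codiscreteWithin {c : ℂ} {R : ℝ} {f₁ f₂ : ℂ → ℝ} (hR : R ≠ 0)
    (hf₁ : CircleIntegrable f₁ c R) (hf₂ : CircleIntegrable f₂ c R)
    (h : ∀ᶠ x in codiscreteWithin (sphere c |R|), f₁ x ≤ f₂ x) :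
    Real.circleAverage f₁ c R ≤ Real.circleAverage f₂ c R := by
  have e : f₁ =ᶠ[codiscreteWithin (sphere c |R|)] fun x ↦ min (f₁ x) (f₂ x) := by
    filter_upwards [h] with x hx
    exact (min_eq_left hx).symm
  rw [Real.circleAverage_congr_codiscreteWithin e hR]
  exact Real.circleAverage_mono (hf₁.congr_codiscreteWithin e) hf₂ fun x _ ↦ min_le_right _ _

/-! ### Poisson majorants -/

/-- The Poisson integral of `|u|` over the circle of radius `R`. -/
def poissonAbs (u : ℂ → ℝ) (R : ℝ) (w : ℂ) : ℝ :=
  Real.circleAverage ((Complex.re ∘ herglotzRieszKernel 0 w) • fun ζ ↦ |u ζ|) 0 R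

lemma circleIntegrable_re_herglotz_smul {u : ℂ → ℝ} {R : ℝ} (hu : CircleIntegrable u 0 R) {w : ℂ}
    (hw : w ∈ ball (0 : ℂ) R) :
    CircleIntegrable ((Complex.re ∘ herglotzRieszKernel 0 w) • u) 0 R :=
  hu.continuousOn_smul (Complex.continuous_re.comp_continuousOn
    (continuousOn_herglotzRieszKernel_sphere hw))

lemma re_herglotz_nonneg {R : ℝ} {w ζ : ℂ} (hw : w ∈ ball (0 : ℂ) R) (hζ : ζ ∈ sphere (0 : ℂ) R) :
    0 ≤ (herglotzRieszKernel 0 w ζ).re := by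
  have h := congrFun (poissonKernel_eq_re_herglotzRieszKernel (c := 0) (w := w)) ζ
  rw [Function.comp_apply] at h
  rw [← h, poissonKernel_def]
  simp only [mem_ball_zero_iff, mem_sphere_zero_iff_norm, sub_zero] at *
  rw [hζ]
  apply div_nonneg _ (by positivity)
  nlinarith [norm_nonneg w]

lemma poissonAbs_nonneg (u : ℂ → ℝ) {R : ℝ} {w : ℂ} (hw : w ∈ ball (0 : ℂ) R) :
    0 ≤ poissonAbs u R w := by
  apply Real.circleAverage_nonneg_of_nonneg
  intro ζ hζ
  rw [abs_of_pos (pos_of_mem_ball hw)] at hζ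
  exact mul_nonneg (re_herglotz_nonneg hw hζ) (abs_nonneg _)

/-- Exhibits the Poisson integral as a harmonic function, the source of its continuity and of its
mean value property. -/
lemma poissonAbs_eq_re {u : ℂ → ℝ} {R : ℝ} (hu : CircleIntegrable u 0 R) :
    ∃ H : ℂ → ℂ, AnalyticOnNhd ℂ H (ball 0 R) ∧
      ∀ w ∈ ball (0 : ℂ) R, poissonAbs u R w = (H w).re := by
  have h1 : CircleIntegrable (fun ζ ↦ ((|u ζ| : ℝ) : ℂ)) 0 R := by
    have := hu.abs
    simp only [CircleIntegrable, intervalIntegrable_iff] at this ⊢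
    exact Complex.ofRealCLM.integrable_comp this
  exact ⟨_, analyticOnNhd_circleAverage_herglotzRieszKernel_smul h1,
    fun w hw ↦ (re_circleAverage_herglotzRieszKernel_smul hu.abs hw).symm⟩

lemma continuousOn_poissonAbs {u : ℂ → ℝ} {R : ℝ} (hu : CircleIntegrable u 0 R) :
    ContinuousOn (poissonAbs u R) (ball 0 R) := by
  obtain ⟨H, hH, e⟩ := poissonAbs_eq_re hu
  exact (Complex.continuous_re.comp_continuousOn hH.continuousOn).congr e

/-- Mean value property; at the centre the kernel equals 1. Thus averaging the majorant over the
smaller circle costs nothing, where a pointwise Harnack bound would lose a further factor 1/(R - r).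
-/
lemma circleAverage_poissonAbs {u : ℂ → ℝ} {R r : ℝ} (hu : CircleIntegrable u 0 R) (hr : 0 ≤ r)
    (hrR : r < R) :
    Real.circleAverage (poissonAbs u R) 0 r = Real.circleAverage (fun ζ ↦ |u ζ|) 0 R := by
  obtain ⟨H, hH, e⟩ := poissonAbs_eq_re hu
  have hsub : closedBall (0 : ℂ) |r| ⊆ ball 0 R := by
    rw [abs_of_nonneg hr]; exact closedBall_subset_ball hrR
  have h1 : Real.circleAverage (poissonAbs u R) 0 r = Real.circleAverage (fun w ↦ (H w).re) 0 r :=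
    Real.circleAverage_congr_sphere fun w hw ↦ e w (hsub (sphere_subset_closedBall hw))
  rw [h1, InnerProductSpace.HarmonicOnNhd.circleAverage_eq (f := fun w ↦ (H w).re)
    (fun w hw ↦ (hH w (hsub hw)).harmonicAt_re),
    ← e 0 (by simp; linarith), poissonAbs]
  apply Real.circleAverage_congr_sphere
  intro ζ hζ
  have hR : 0 < R := lt_of_le_of_lt hr hrR
  have : ζ ≠ 0 := by
    rintro rfl; simp [abs_of_pos hR] at hζ; linarith
  simp [herglotzRieszKernel_def, this]

lemma le_poissonAbs {u : ℂ → ℝ} {R : ℝ} {w : ℂ}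
    (hu : InnerProductSpace.HarmonicOnNhd u (closedBall 0 R)) (hci : CircleIntegrable u 0 R)
    (hw : w ∈ ball (0 : ℂ) R) : u w ≤ poissonAbs u R w := by
  rw [← hu.circleAverage_re_herglotzRieszKernel_smul hw, poissonAbs]
  apply Real.circleAverage_mono (circleIntegrable_re_herglotz_smul hci hw)
    (circleIntegrable_re_herglotz_smul hci.abs hw)
  intro ζ hζ
  rw [abs_of_pos (pos_of_mem_ball hw)] at hζ
  exact mul_le_mul_of_nonneg_left (le_abs_self _) (re_herglotz_nonneg hw hζ)

lemma poissonAbs_le {u : ℂ → ℝ} {R : ℝ} {w : ℂ} (hci : CircleIntegrable u 0 R)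
    (hw : w ∈ ball (0 : ℂ) R) :
    poissonAbs u R w ≤ (R + ‖w‖) / (R - ‖w‖) * Real.circleAverage (fun ζ ↦ |u ζ|) 0 R := by
  rw [poissonAbs, ← smul_eq_mul, ← Real.circleAverage_fun_smul]
  apply Real.circleAverage_mono (circleIntegrable_re_herglotz_smul hci.abs hw)
    (hci.abs.const_smul)
  intro ζ hζ
  rw [abs_of_pos (pos_of_mem_ball hw)] at hζ
  apply mul_le_mul_of_nonneg_right _ (abs_nonneg _)
  simpa [herglotzRieszKernel_def] using re_herglotzRieszKernel_le hζ hw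

/-- The Herglotz kernels at w' and w differ by 2ζ(w' - w)/((ζ - w')(ζ - w)). As w' stays within half
the distance from w to the circle, |ζ - w'| ≥ |ζ - w|/2, and the difference is bounded by a multiple
of the Poisson kernel at w itself, so the estimate integrates back to `poissonAbs` at w. -/
lemma sub_le_poissonAbs {u : ℂ → ℝ} {R : ℝ} {w w' : ℂ}
    (hu : InnerProductSpace.HarmonicOnNhd u (closedBall 0 R)) (hci : CircleIntegrable u 0 R)
    (hw : w ∈ ball (0 : ℂ) R) (hw' : ‖w' - w‖ ≤ (R - ‖w‖) / 2) :
    u w' - u w ≤ 4 * ‖w' - w‖ / (R - ‖w‖) * poissonAbs u R w := by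
  have hwn : ‖w‖ < R := mem_ball_zero_iff.1 hw
  have hR : 0 < R := pos_of_mem_ball hw
  have hw'R : w' ∈ ball (0 : ℂ) R := by
    rw [mem_ball_zero_iff]
    have : ‖w'‖ ≤ ‖w‖ + ‖w' - w‖ := by
      calc ‖w'‖ = ‖w + (w' - w)‖ := by ring_nf
        _ ≤ _ := norm_add_le _ _
    linarith
  have i1 := circleIntegrable_re_herglotz_smul hci hw
  have i2 := circleIntegrable_re_herglotz_smul hci hw'R
  rw [← hu.circleAverage_re_herglotzRieszKernel_smul hw,
    ← hu.circleAverage_re_herglotzRieszKernel_smul hw'R, ← Real.circleAverage_sub i2 i1,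
    poissonAbs, ← smul_eq_mul, ← Real.circleAverage_smul]
  apply Real.circleAverage_mono (i2.sub i1)
    (circleIntegrable_re_herglotz_smul hci.abs hw).const_smul
  intro ζ hζ
  rw [abs_of_pos hR] at hζ
  have hζn : ‖ζ‖ = R := mem_sphere_zero_iff_norm.1 hζ
  have hP : (herglotzRieszKernel 0 w ζ).re = (R ^ 2 - ‖w‖ ^ 2) / ‖ζ - w‖ ^ 2 := by
    have h := congrFun (poissonKernel_eq_re_herglotzRieszKernel (c := 0) (w := w)) ζ
    rw [Function.comp_apply] at h
    rw [← h, poissonKernel_def]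
    simp [hζn]
  have d1 : R - ‖w‖ ≤ ‖ζ - w‖ := by rw [← hζn]; exact norm_sub_norm_le _ _
  have d1' : 0 < ‖ζ - w‖ := by linarith
  have d2 : ‖ζ - w‖ / 2 ≤ ‖ζ - w'‖ := by
    have : ‖ζ - w‖ ≤ ‖ζ - w'‖ + ‖w' - w‖ := norm_sub_le_norm_sub_add_norm_sub _ _ _
    linarith
  have d2' : 0 < ‖ζ - w'‖ := by linarith
  have ediff : herglotzRieszKernel 0 w' ζ - herglotzRieszKernel 0 w ζ =
      2 * ζ * (w' - w) / ((ζ - w') * (ζ - w)) := by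
    have n1 : ζ - w ≠ 0 := norm_pos_iff.1 d1'
    have n2 : ζ - w' ≠ 0 := norm_pos_iff.1 d2'
    simp only [herglotzRieszKernel_def, sub_zero]
    field_simp
    ring
  have hK : |(herglotzRieszKernel 0 w' ζ).re - (herglotzRieszKernel 0 w ζ).re| ≤
      4 * ‖w' - w‖ / (R - ‖w‖) * (herglotzRieszKernel 0 w ζ).re := by
    rw [← Complex.sub_re]
    refine (Complex.abs_re_le_norm _).trans ?_
    rw [ediff, hP]
    simp only [norm_div, norm_mul, hζn, Complex.norm_ofNat]
    have h3 : 0 < R - ‖w‖ := by linarith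
    calc 2 * R * ‖w' - w‖ / (‖ζ - w'‖ * ‖ζ - w‖)
        ≤ 2 * R * ‖w' - w‖ / (‖ζ - w‖ / 2 * ‖ζ - w‖) := by gcongr
      _ = 4 * ‖w' - w‖ / (R - ‖w‖) * ((R * (R - ‖w‖)) / ‖ζ - w‖ ^ 2) := by
          field_simp; ring
      _ ≤ _ := by
          gcongr
          nlinarith [norm_nonneg w]
  change (herglotzRieszKernel 0 w' ζ).re * u ζ - (herglotzRieszKernel 0 w ζ).re * u ζ ≤
    4 * ‖w' - w‖ / (R - ‖w‖) * ((herglotzRieszKernel 0 w ζ).re * |u ζ|)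
  calc (herglotzRieszKernel 0 w' ζ).re * u ζ - (herglotzRieszKernel 0 w ζ).re * u ζ
      ≤ |((herglotzRieszKernel 0 w' ζ).re - (herglotzRieszKernel 0 w ζ).re) * u ζ| := by
        rw [← sub_mul]; exact le_abs_self _
    _ ≤ (4 * ‖w' - w‖ / (R - ‖w‖) * (herglotzRieszKernel 0 w ζ).re) * |u ζ| := by
        rw [abs_mul]; gcongr
    _ = _ := by ring

/-! ### The Poisson–Jensen formula -/

lemma abs_log_eq_posLog_add (x : ℝ) : |Real.log x| = Real.posLog x + Real.posLog x⁻¹ := by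
  rw [← Real.half_mul_log_add_log_abs, ← Real.half_mul_log_add_log_abs, Real.log_inv, abs_neg]
  ring

lemma exists_finset_mem_iff {A : Set ℂ} (hA : A ∈ codiscrete ℂ) (R : ℝ) :
    ∃ S : Finset ℂ, ∀ z, z ∈ S ↔ z ∈ ball (0 : ℂ) R ∧ z ∉ A := by
  have hfin : (closedBall (0 : ℂ) R \ A).Finite :=
    (isCompact_closedBall 0 R).finite_sdiff_of_mem_codiscreteWithin
      (codiscreteWithin_mono (subset_univ _) hA)
  have hfin' : (ball (0 : ℂ) R \ A).Finite :=
    hfin.subset (sdiff_subset_sdiff_left ball_subset_closedBall)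
  exact ⟨hfin'.toFinset, fun z ↦ by simp⟩

lemma divisor_eq_zero_of_ne_zero {g : ℂ → ℂ} (hg : Meromorphic g) {z : ℂ} (h1 : AnalyticAt ℂ g z)
    (h2 : g z ≠ 0) : divisor g univ z = 0 := by
  rw [divisor_apply hg.meromorphicOn (mem_univ z),
    h1.meromorphicNFAt.meromorphicOrderAt_eq_zero_iff.2 h2]
  simp

lemma eventually_analyticAt_and_ne_zero {g : ℂ → ℂ} (hg : Meromorphic g)
    (hg0 : ∀ z, meromorphicOrderAt g z ≠ ⊤) : {z | AnalyticAt ℂ g z ∧ g z ≠ 0} ∈ codiscrete ℂ :=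
  Filter.inter_mem (hg.meromorphicOn.analyticAt_mem_codiscreteWithin (U := univ))
    (hg.meromorphicOn.eventually_codiscreteWithin_apply_ne_zero fun z _ ↦ hg0 z)

lemma exists_radius_divisor_eq_zero (D : Function.locallyFinsupp ℂ ℤ)
    {a b : ℝ} (hab : a < b) : ∃ R ∈ Ioo a b, ∀ z ∈ sphere (0 : ℂ) R, D z = 0 := by
  have hfin : (closedBall (0 : ℂ) b ∩ Function.support D).Finite :=
    D.locallyFiniteSupport.finite_inter_support_of_isCompact (isCompact_closedBall 0 b)
  obtain ⟨R, hR, hR'⟩ := (Ioo_infinite hab).exists_notMem_finite (hfin.image fun z ↦ ‖z‖)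
  refine ⟨R, hR, fun z hz ↦ ?_⟩
  by_contra h0
  rw [mem_sphere_zero_iff_norm] at hz
  exact hR' ⟨z, ⟨by simp [hz, hR.2.le], h0⟩, hz⟩

lemma divisor_eq_divisor_univ {g : ℂ → ℂ} (hg : Meromorphic g) {U : Set ℂ} {z : ℂ} (hz : z ∈ U) :
    divisor g U z = divisor g univ z := by
  rw [divisor_apply hg.meromorphicOn hz, divisor_apply hg.meromorphicOn (mem_univ z)]

/-- Here u = log|h|, with h the zero-free and pole-free part of the canonical decomposition.
Canonical factors have modulus 1 on the circle, so |u| agrees there with |log|g|| off a discrete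
set, and its mean is the sum of the two proximity functions. The factor at i has its pole at i,
which explains the minus sign. -/
lemma exists_poissonJensen {g : ℂ → ℂ} (hg : Meromorphic g)
    (hg0 : ∀ z, meromorphicOrderAt g z ≠ ⊤) {R : ℝ} (hR : 0 < R)
    (hsph : ∀ z ∈ sphere (0 : ℂ) R, divisor g univ z = 0) {S : Finset ℂ}
    (hS : ∀ z ∈ ball (0 : ℂ) R, divisor g univ z ≠ 0 → z ∈ S) (hS' : ∀ z ∈ S, z ∈ ball (0 : ℂ) R) :
    ∃ u : ℂ → ℝ, InnerProductSpace.HarmonicOnNhd u (closedBall 0 R) ∧ CircleIntegrable u 0 R ∧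
      Real.circleAverage (fun ζ ↦ |u ζ|) 0 R =
        ValueDistribution.proximity g ⊤ R + ValueDistribution.proximity g⁻¹ ⊤ R ∧
      ∀ w ∈ ball (0 : ℂ) R, AnalyticAt ℂ g w → g w ≠ 0 → Real.log ‖g w‖ =
        u w - ∑ i ∈ S, (divisor g univ i : ℝ) * Real.log ‖Complex.canonicalFactor R i w‖ := by
  obtain ⟨h, D⟩ := (hg.meromorphicOn (s := closedBall 0 R)).exists_ecanonicalDecomp
    fun u ↦ hg0 u
  have hlog : ∀ w ∈ closedBall (0 : ℂ) R, AnalyticAt ℂ g w → g w ≠ 0 → Real.log ‖h w‖ =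
      ∑ i ∈ S, (divisor g univ i : ℝ) * Real.log ‖Complex.canonicalFactor R i w‖ +
        Real.log ‖g w‖ := by
    intro w hw h1 h2
    rw [D.log_norm_eq hw (h1.meromorphicNFAt.meromorphicOrderAt_eq_zero_iff.2 h2) hR,
      h1.meromorphicTrailingCoeffAt_of_ne_zero h2]
    have e1 : ∑ᶠ i, ((divisor g (sphere 0 R) i : ℤ) : ℝ) * Real.log ‖w - i‖ = 0 := by
      apply finsum_eq_zero_of_forall_eq_zero
      intro i
      by_cases hi : i ∈ sphere (0 : ℂ) R
      · rw [divisor_eq_divisor_univ hg hi, hsph i hi]; simp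
      · rw [Function.locallyFinsuppWithin.apply_eq_zero_of_notMem _ hi]; simp
    have e2 : ∑ᶠ i, ((divisor g (ball 0 R) i : ℤ) : ℝ) *
        Real.log ‖Complex.canonicalFactor R i w‖ =
        ∑ i ∈ S, (divisor g univ i : ℝ) * Real.log ‖Complex.canonicalFactor R i w‖ := by
      rw [finsum_eq_sum_of_support_subset (s := S)]
      · exact Finset.sum_congr rfl fun i hi ↦ by rw [divisor_eq_divisor_univ hg (hS' i hi)]
      · intro i hi
        have hi' : divisor g (ball 0 R) i ≠ 0 := fun h0 ↦ hi (by simp [h0])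
        have hib : i ∈ ball (0 : ℂ) R := by
          by_contra hn
          exact hi' (Function.locallyFinsuppWithin.apply_eq_zero_of_notMem _ hn)
        exact hS i hib (by rwa [divisor_eq_divisor_univ hg hib] at hi')
    rw [e1, e2, sub_zero]
  have hharm : InnerProductSpace.HarmonicOnNhd (fun w ↦ Real.log ‖h w‖) (closedBall 0 R) :=
    fun w hw ↦ (D.analyticOnNhd w hw).harmonicAt_log_norm (D.ne_zero w hw)
  refine ⟨fun w ↦ Real.log ‖h w‖, hharm, ?_, ?_, fun w hw h1 h2 ↦ ?_⟩
  · apply MeromorphicOn.circleIntegrable_log_norm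
    rw [abs_of_pos hR]
    exact fun z hz ↦ (D.analyticOnNhd z (sphere_subset_closedBall hz)).meromorphicAt
  · have e : (fun ζ ↦ |Real.log ‖h ζ‖|) =ᶠ[codiscreteWithin (sphere (0 : ℂ) |R|)]
        (fun ζ ↦ Real.posLog ‖g ζ‖) + fun ζ ↦ Real.posLog ‖g⁻¹ ζ‖ := by
      filter_upwards [codiscreteWithin_mono (subset_univ _)
        (eventually_analyticAt_and_ne_zero hg hg0), self_mem_codiscreteWithin _] with ζ h1 h2
      rw [abs_of_pos hR] at h2
      rw [hlog ζ (sphere_subset_closedBall h2) h1.1 h1.2, Finset.sum_eq_zero, zero_add,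
        abs_log_eq_posLog_add]
      · simp
      · intro i hi
        rw [Complex.norm_canonicalFactor_eval_circle_eq_one (hS' i hi) h2]
        simp
    rw [Real.circleAverage_congr_codiscreteWithin e hR.ne', Real.circleAverage_add,
      ValueDistribution.proximity_top, ValueDistribution.proximity_top]
    · exact hg.meromorphicOn.circleIntegrable_posLog_norm
    · exact hg.inv.meromorphicOn.circleIntegrable_posLog_norm
  · change _ = Real.log ‖h w‖ - _
    rw [hlog w (ball_subset_closedBall hw) h1 h2]; ring

/-! ### Variation of the canonical factors -/

lemma abs_log_sub_log_le {a b d : ℝ} (ha : 0 < a) (hb : 0 < b) (h : |a - b| ≤ d) :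
    |Real.log a - Real.log b| ≤ Real.log (1 + d / a) + Real.log (1 + d / b) := by
  have hd : 0 ≤ d := (abs_nonneg _).trans h
  obtain ⟨h1, h2⟩ := abs_le.1 h
  have p1 : 0 ≤ Real.log (1 + d / a) := Real.log_nonneg (by
    have : 0 ≤ d / a := by positivity
    linarith)
  have p2 : 0 ≤ Real.log (1 + d / b) := Real.log_nonneg (by
    have : 0 ≤ d / b := by positivity
    linarith)
  have aux : ∀ x y : ℝ, 0 < x → 0 < y → x ≤ y + d →
      Real.log x - Real.log y ≤ Real.log (1 + d / y) := by
    intro x y hx hy hxy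
    rw [← Real.log_div hx.ne' hy.ne']
    apply Real.log_le_log (by positivity)
    rw [div_le_iff₀ hy]
    field_simp
    linarith
  rw [abs_le]
  constructor
  · linarith [aux b a hb ha (by linarith)]
  · linarith [aux a b ha hb (by linarith)]

/-- The difference of the squares of the two sides is (R² - |i|²)(R² - |z|²). -/
lemma mul_norm_sub_le_norm_sq_sub {R : ℝ} {i z : ℂ} (hi : i ∈ ball (0 : ℂ) R)
    (hz : z ∈ ball (0 : ℂ) R) : R * ‖z - i‖ ≤ ‖(R : ℂ) ^ 2 - conj i * z‖ := by
  have hR := (pos_of_mem_ball hi).le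
  rw [mem_ball_zero_iff] at hi hz
  have h1 : ‖i‖ ^ 2 ≤ R ^ 2 := by gcongr
  have h2 : ‖z‖ ^ 2 ≤ R ^ 2 := by gcongr
  have h3 : 0 ≤ (R ^ 2 - ‖i‖ ^ 2) * (R ^ 2 - ‖z‖ ^ 2) := mul_nonneg (by linarith) (by linarith)
  rw [← sq_le_sq₀ (by positivity) (norm_nonneg _), mul_pow, ← Complex.normSq_eq_norm_sq,
    ← Complex.normSq_eq_norm_sq, Complex.normSq_apply, Complex.normSq_apply]
  rw [← Complex.normSq_eq_norm_sq, ← Complex.normSq_eq_norm_sq, Complex.normSq_apply,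
    Complex.normSq_apply] at h3
  have e1 : ((R : ℂ) ^ 2 - conj i * z).re = R ^ 2 - (i.re * z.re + i.im * z.im) := by
    rw [Complex.sub_re, ← Complex.ofReal_pow, Complex.ofReal_re]; simp [Complex.mul_re]
  have e2 : ((R : ℂ) ^ 2 - conj i * z).im = -(i.re * z.im - i.im * z.re) := by
    rw [Complex.sub_im, ← Complex.ofReal_pow, Complex.ofReal_im]; simp [Complex.mul_im]; ring
  rw [e1, e2, Complex.sub_re, Complex.sub_im]
  nlinarith

lemma log_norm_canonicalFactor {R : ℝ} {i z : ℂ} (hi : i ∈ ball (0 : ℂ) R)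
    (hz : z ∈ ball (0 : ℂ) R) (hzi : z ≠ i) : Real.log ‖Complex.canonicalFactor R i z‖ =
      Real.log ‖(R : ℂ) ^ 2 - conj i * z‖ - Real.log R - Real.log ‖z - i‖ := by
  have hR := pos_of_mem_ball hi
  have h1 : 0 < ‖z - i‖ := norm_pos_iff.2 (sub_ne_zero.2 hzi)
  have h2 := mul_norm_sub_le_norm_sq_sub hi hz
  have h3 : 0 < ‖(R : ℂ) ^ 2 - conj i * z‖ := lt_of_lt_of_le (by positivity) h2
  rw [Complex.canonicalFactor_apply, norm_div, norm_mul, Complex.norm_real,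
    Real.norm_of_nonneg hR.le, Real.log_div h3.ne' (by positivity), Real.log_mul hR.ne' h1.ne']
  ring

lemma log_norm_canonicalFactor_nonneg {R : ℝ} {i z : ℂ} (hi : i ∈ ball (0 : ℂ) R)
    (hz : z ∈ ball (0 : ℂ) R) (hzi : z ≠ i) :
    0 ≤ Real.log ‖Complex.canonicalFactor R i z‖ := by
  have hR := pos_of_mem_ball hi
  have h1 : 0 < ‖z - i‖ := norm_pos_iff.2 (sub_ne_zero.2 hzi)
  have := Real.log_le_log (by positivity) (mul_norm_sub_le_norm_sq_sub hi hz)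
  rw [Real.log_mul hR.ne' h1.ne'] at this
  rw [log_norm_canonicalFactor hi hz hzi]
  linarith

lemma log_norm_canonicalFactor_le {R : ℝ} {i z : ℂ} (hi : i ∈ ball (0 : ℂ) R)
    (hz : z ∈ ball (0 : ℂ) R) (hzi : z ≠ i) :
    Real.log ‖Complex.canonicalFactor R i z‖ ≤ Real.log (2 * R / ‖z - i‖) := by
  have hR := pos_of_mem_ball hi
  have h1 : 0 < ‖z - i‖ := norm_pos_iff.2 (sub_ne_zero.2 hzi)
  have h2 := mul_norm_sub_le_norm_sq_sub hi hz
  have h3 : 0 < ‖(R : ℂ) ^ 2 - conj i * z‖ := lt_of_lt_of_le (by positivity) h2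
  apply Real.log_le_log
  · rw [Complex.canonicalFactor_apply, norm_div, norm_mul, Complex.norm_real,
      Real.norm_of_nonneg hR.le]
    positivity
  rw [mem_ball_zero_iff] at hi hz
  rw [Complex.canonicalFactor_apply, norm_div, norm_mul, Complex.norm_real,
    Real.norm_of_nonneg hR.le, div_le_div_iff₀ (by positivity) h1]
  have h4 : ‖(R : ℂ) ^ 2 - conj i * z‖ ≤ 2 * R ^ 2 := by
    calc ‖(R : ℂ) ^ 2 - conj i * z‖ ≤ ‖(R : ℂ) ^ 2‖ + ‖conj i * z‖ := norm_sub_le _ _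
      _ = R ^ 2 + ‖i‖ * ‖z‖ := by
        rw [norm_pow, norm_mul, RCLike.norm_conj, Complex.norm_real, Real.norm_of_nonneg hR.le]
      _ ≤ R ^ 2 + R * R := by gcongr
      _ = _ := by ring
  nlinarith

/-- The numerator R² - conj(i)z and the denominator z - i vary separately, and the relative
variation of the numerator is no larger than that of the denominator; hence the factors 2. -/
lemma abs_log_canonicalFactor_sub_le {R : ℝ} {i z z' : ℂ} (hi : i ∈ ball (0 : ℂ) R)
    (hz : z ∈ ball (0 : ℂ) R) (hz' : z' ∈ ball (0 : ℂ) R) (hzi : z ≠ i) (hzi' : z' ≠ i) :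
    |Real.log ‖Complex.canonicalFactor R i z'‖ - Real.log ‖Complex.canonicalFactor R i z‖| ≤
      2 * Real.log (1 + ‖z' - z‖ / ‖z - i‖) + 2 * Real.log (1 + ‖z' - z‖ / ‖z' - i‖) := by
  have hR := pos_of_mem_ball hi
  have h1 : 0 < ‖z - i‖ := norm_pos_iff.2 (sub_ne_zero.2 hzi)
  have h1' : 0 < ‖z' - i‖ := norm_pos_iff.2 (sub_ne_zero.2 hzi')
  have h2 := mul_norm_sub_le_norm_sq_sub hi hz
  have h2' := mul_norm_sub_le_norm_sq_sub hi hz'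
  have h3 : 0 < ‖(R : ℂ) ^ 2 - conj i * z‖ := lt_of_lt_of_le (by positivity) h2
  have h3' : 0 < ‖(R : ℂ) ^ 2 - conj i * z'‖ := lt_of_lt_of_le (by positivity) h2'
  rw [log_norm_canonicalFactor hi hz hzi, log_norm_canonicalFactor hi hz' hzi']
  have q1 : |Real.log ‖z' - i‖ - Real.log ‖z - i‖| ≤
      Real.log (1 + ‖z' - z‖ / ‖z' - i‖) + Real.log (1 + ‖z' - z‖ / ‖z - i‖) := by
    apply abs_log_sub_log_le h1' h1
    refine (abs_norm_sub_norm_le _ _).trans (le_of_eq ?_)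
    congr 1; ring
  have q2 : |Real.log ‖(R : ℂ) ^ 2 - conj i * z'‖ - Real.log ‖(R : ℂ) ^ 2 - conj i * z‖| ≤
      Real.log (1 + R * ‖z' - z‖ / ‖(R : ℂ) ^ 2 - conj i * z'‖) +
        Real.log (1 + R * ‖z' - z‖ / ‖(R : ℂ) ^ 2 - conj i * z‖) := by
    apply abs_log_sub_log_le h3' h3
    refine (abs_norm_sub_norm_le _ _).trans ?_
    have : (R : ℂ) ^ 2 - conj i * z' - (R ^ 2 - conj i * z) = -(conj i * (z' - z)) := by ring
    rw [this, norm_neg, norm_mul, RCLike.norm_conj]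
    gcongr
    exact (mem_ball_zero_iff.1 hi).le
  have q3 : ∀ y : ℂ, 0 < ‖y - i‖ → R * ‖y - i‖ ≤ ‖(R : ℂ) ^ 2 - conj i * y‖ →
      Real.log (1 + R * ‖z' - z‖ / ‖(R : ℂ) ^ 2 - conj i * y‖) ≤
        Real.log (1 + ‖z' - z‖ / ‖y - i‖) := by
    intro y hy hy'
    apply Real.log_le_log (by positivity)
    have : R * ‖z' - z‖ / ‖(R : ℂ) ^ 2 - conj i * y‖ ≤ R * ‖z' - z‖ / (R * ‖y - i‖) := by
      gcongr
    rw [mul_div_mul_left _ _ hR.ne'] at this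
    linarith
  have q4 := q3 z h1 h2
  have q5 := q3 z' h1' h2'
  rw [abs_le] at q1 q2 ⊢
  constructor <;> linarith [q1.1, q1.2, q2.1, q2.2]

/-! ### Counting -/

/-- A point of modulus at most R contributes at least log(R'/R) to the counting function at R'. -/
lemma sum_mul_log_le_logCounting {D : Function.locallyFinsupp ℂ ℤ} (hD : 0 ≤ D) {R R' : ℝ}
    (hR : 1 ≤ R) (hRR' : R ≤ R') {S : Finset ℂ} (hS : ∀ z ∈ S, ‖z‖ ≤ R) :
    (∑ i ∈ S, (D i : ℝ)) * Real.log (R' / R) ≤ D.logCounting R' := by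
  classical
  open Function.locallyFinsuppWithin in
  have hle : ∑ i ∈ S, single i (D i) ≤ D := by
    rw [Function.locallyFinsuppWithin.le_def, Pi.le_def]
    intro w
    simp only [coe_sum, Finset.sum_apply, single_apply, Finset.sum_ite_eq]
    by_cases hw : w ∈ S
    · simp [hw]
    · simpa [hw] using (Function.locallyFinsuppWithin.le_def.1 hD) w
  have h1 := Function.locallyFinsuppWithin.logCounting_le hle (hR.trans hRR')
  refine le_trans ?_ h1
  rw [map_sum, Finset.sum_apply, Finset.sum_mul]
  refine Finset.sum_le_sum fun i hi ↦ ?_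
  rw [Function.locallyFinsuppWithin.logCounting_single_eq_log_sub_const ((hS i hi).trans hRR'),
    Real.log_div (by linarith) (by linarith)]
  have h2 : (0 : ℝ) ≤ D i := by exact_mod_cast (Function.locallyFinsuppWithin.le_def.1 hD) i
  apply mul_le_mul_of_nonneg_left _ h2
  have h3 : Real.log ‖i‖ ≤ Real.log R := by
    -- A point at the origin counts with weight log R'. The value `Real.log 0 = 0` encodes this, and
    -- 1 ≤ R makes the comparison valid.
    by_cases h0 : ‖i‖ = 0
    · rw [h0, Real.log_zero]; exact Real.log_nonneg hR
    · exact Real.log_le_log (lt_of_le_of_ne (norm_nonneg _) (Ne.symm h0)) (hS i hi)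
  linarith

lemma sum_abs_divisor_mul_log_le (g : ℂ → ℂ) {R R' : ℝ} (hR : 1 ≤ R) (hRR' : R ≤ R')
    {S : Finset ℂ} (hS : ∀ z ∈ S, ‖z‖ ≤ R) :
    (∑ i ∈ S, |(divisor g univ i : ℝ)|) * Real.log (R' / R) ≤
      ValueDistribution.logCounting g ⊤ R' + ValueDistribution.logCounting g⁻¹ ⊤ R' := by
  have h1 := sum_mul_log_le_logCounting (negPart_nonneg (divisor g univ)) hR hRR' hS
  have h2 := sum_mul_log_le_logCounting (posPart_nonneg (divisor g univ)) hR hRR' hS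
  rw [ValueDistribution.logCounting_inv, ValueDistribution.logCounting_top,
    ValueDistribution.logCounting_zero]
  have e : ∑ i ∈ S, |(divisor g univ i : ℝ)| =
      ∑ i ∈ S, (((divisor g univ)⁻ i : ℤ) : ℝ) + ∑ i ∈ S, (((divisor g univ)⁺ i : ℤ) : ℝ) := by
    rw [← Finset.sum_add_distrib]
    refine Finset.sum_congr rfl fun i _ ↦ ?_
    rw [Function.locallyFinsuppWithin.negPart_apply, Function.locallyFinsuppWithin.posPart_apply,
      ← Int.cast_abs, ← posPart_add_negPart]
    push_cast; ring
  rw [e, add_mul]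
  linarith

/-! ### The proximity function of the shift quotient -/

lemma meromorphic_shiftQuotient {f : ℂ → ℂ} (hf : Meromorphic f) (a w : ℂ) :
    Meromorphic (VarShift.shiftQuotient f a w) := by
  have h1 : Meromorphic fun z ↦ f (z + w) := fun z ↦
    (hf (z + w)).comp_analyticAt (g := fun z ↦ z + w) (by fun_prop)
  have h2 := hf.deriv
  unfold VarShift.shiftQuotient
  intro z
  have h1 := h1 z
  have h2 := h2 z
  have h3 := hf z
  fun_prop

/-- Trades a logarithmic singularity for an integrable power one. The reward is the factor δ^α,
almost a full power of the shift when α is near 1. -/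
lemma log_one_add_div_le {α d δ x : ℝ} (hα : 0 < α) (hα' : α ≤ 1) (hd : 0 ≤ d) (hδ : d ≤ δ)
    (hx : 0 ≤ x) : Real.log (1 + d / x) ≤ δ ^ α / α * x ^ (-α) := by
  refine (log_one_add_le_rpow hα hα' (by positivity)).trans ?_
  rw [Real.div_rpow hd hx, Real.rpow_neg hx]
  calc d ^ α / x ^ α / α ≤ δ ^ α / x ^ α / α := by gcongr
    _ = _ := by ring

/-- Bound for the growth of `log ‖g‖` between two points, in terms of a Poisson–Jensen
representation `log ‖g‖ = u - ∑ dᵢ log ‖canonicalFactor R i‖`. -/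
lemma log_sub_log_le_of_poissonJensen {α : ℝ} (hα : 0 < α) (hα' : α ≤ 1) {R δ : ℝ} {S : Finset ℂ}
    {u : ℂ → ℝ} (hu : InnerProductSpace.HarmonicOnNhd u (closedBall 0 R))
    (hci : CircleIntegrable u 0 R) (hS' : ∀ z ∈ S, z ∈ ball (0 : ℂ) R) (d : ℂ → ℝ) {z z' : ℂ}
    (hz : z ∈ ball (0 : ℂ) R) (hz' : z' ∈ ball (0 : ℂ) R) (hzS : z ∉ S) (hzS' : z' ∉ S)
    (hδ : ‖z' - z‖ ≤ δ) (hδR : δ ≤ (R - ‖z‖) / 2) :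
    (u z' - ∑ i ∈ S, d i * Real.log ‖Complex.canonicalFactor R i z'‖) -
      (u z - ∑ i ∈ S, d i * Real.log ‖Complex.canonicalFactor R i z‖) ≤
    4 * δ / (R - ‖z‖) * poissonAbs u R z +
      2 * (δ ^ α / α) * (∑ i ∈ S, |d i| * ‖z - i‖ ^ (-α) + ∑ i ∈ S, |d i| * ‖z' - i‖ ^ (-α)) := by
  have h1 := sub_le_poissonAbs hu hci hz (hδ.trans hδR)
  have hRz : 0 < R - ‖z‖ := by rw [mem_ball_zero_iff] at hz; linarith
  have h2 : 4 * ‖z' - z‖ / (R - ‖z‖) * poissonAbs u R z ≤ 4 * δ / (R - ‖z‖) * poissonAbs u R z := by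
    gcongr
    exact poissonAbs_nonneg u hz
  have h3 : -(∑ i ∈ S, d i * Real.log ‖Complex.canonicalFactor R i z'‖) +
      ∑ i ∈ S, d i * Real.log ‖Complex.canonicalFactor R i z‖ ≤
      2 * (δ ^ α / α) *
        (∑ i ∈ S, |d i| * ‖z - i‖ ^ (-α) + ∑ i ∈ S, |d i| * ‖z' - i‖ ^ (-α)) := by
    rw [← Finset.sum_add_distrib, Finset.mul_sum, ← Finset.sum_neg_distrib,
      ← Finset.sum_add_distrib]
    refine Finset.sum_le_sum fun i hi ↦ ?_
    have hzi : z ≠ i := by rintro rfl; exact hzS hi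
    have hzi' : z' ≠ i := by rintro rfl; exact hzS' hi
    have e1 := abs_log_canonicalFactor_sub_le (hS' i hi) hz hz' hzi hzi'
    have e2 := log_one_add_div_le hα hα' (norm_nonneg (z' - z)) hδ (norm_nonneg (z - i))
    have e3 := log_one_add_div_le hα hα' (norm_nonneg (z' - z)) hδ (norm_nonneg (z' - i))
    calc -(d i * Real.log ‖Complex.canonicalFactor R i z'‖) +
          d i * Real.log ‖Complex.canonicalFactor R i z‖
        = -(d i * (Real.log ‖Complex.canonicalFactor R i z'‖ -
            Real.log ‖Complex.canonicalFactor R i z‖)) := by ring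
      _ ≤ |d i| * |Real.log ‖Complex.canonicalFactor R i z'‖ -
            Real.log ‖Complex.canonicalFactor R i z‖| := by
          rw [← abs_mul]; exact neg_le_abs _
      _ ≤ |d i| * (2 * (δ ^ α / α * ‖z - i‖ ^ (-α)) + 2 * (δ ^ α / α * ‖z' - i‖ ^ (-α))) := by
          gcongr
          linarith
      _ = _ := by ring
  linarith

/-- f(z) - az is a primitive of g, and each of the two legs has length at most 2|w|, whence 4|w|.
Both legs stay within 2|w| of z, so the Poisson–Jensen variation estimate bounds log|g| on them by
log|g(z)| + Ψ. -/
lemma exists_posLog_shiftQuotient_le {α : ℝ} (hα : 0 < α) (hα' : α < 1) :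
    ∃ C : ℝ, 0 < C ∧ ∀ {f : ℂ → ℂ} {a w : ℂ} {R : ℝ} {S : Finset ℂ} {u : ℂ → ℝ} {d : ℂ → ℝ},
      w ≠ 0 → InnerProductSpace.HarmonicOnNhd u (closedBall 0 R) → CircleIntegrable u 0 R →
      (∀ z ∈ S, z ∈ ball (0 : ℂ) R) →
      (∀ z ∈ ball (0 : ℂ) R, z ∉ S → AnalyticAt ℂ f z ∧ deriv f z - a ≠ 0 ∧
        Real.log ‖deriv f z - a‖ =
          u z - ∑ i ∈ S, d i * Real.log ‖Complex.canonicalFactor R i z‖) →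
      ∀ z : ℂ, 4 * ‖w‖ ≤ R - ‖z‖ → z ∉ S → z + w ∉ S →
      Real.posLog ‖VarShift.shiftQuotient f a w z‖ ≤ Real.posLog (4 * ‖w‖) +
        (8 * ‖w‖ / (R - ‖z‖) * poissonAbs u R z +
          C * ‖w‖ ^ α * ∑ i ∈ S, |d i| * (‖z - i‖ ^ (-α) + ‖z + w - i‖ ^ (-α))) := by
  obtain ⟨C, hC, hpath⟩ := exists_polygonal_path hα hα'
  -- The factor 2^α comes from the displacement bound 2|w|; the 1 accounts for the potential at z
  -- and the C for the potential at the moving point of the detour.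
  refine ⟨2 * (2 ^ α / α) * (1 + C), by positivity, ?_⟩
  intro f a w R S u d hw hu hci hS' hfS z hzR hzS hzwS
  have hw' : 0 < ‖w‖ := norm_pos_iff.2 hw
  have hz : z ∈ ball (0 : ℂ) R := by rw [mem_ball_zero_iff]; linarith
  obtain ⟨q, hq1, hq2, hq⟩ := hpath S (fun i ↦ |d i|) (fun i ↦ abs_nonneg _) z w hw hzS hzwS
  set W := ∑ i ∈ S, |d i| * (‖z - i‖ ^ (-α) + ‖z + w - i‖ ^ (-α)) with hW
  set Ψ := 8 * ‖w‖ / (R - ‖z‖) * poissonAbs u R z +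
    2 * (2 ^ α / α) * (1 + C) * ‖w‖ ^ α * W with hΨ
  have hW0 : 0 ≤ W := Finset.sum_nonneg fun i _ ↦ by positivity
  have hΨ0 : 0 ≤ Ψ := by
    have := poissonAbs_nonneg u hz
    have h2 : 0 < R - ‖z‖ := by linarith
    positivity
  obtain ⟨hz1, hz2, hz3⟩ := hfS z hz hzS
  set g : ℂ → ℂ := fun z ↦ deriv f z - a with hg
  have key : ∀ z' ∈ segment ℝ z q ∪ segment ℝ (z + w) q, AnalyticAt ℂ f z' ∧
      ‖g z'‖ ≤ ‖g z‖ * Real.exp Ψ := by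
    intro z' hz'
    have hdist : ‖z' - z‖ ≤ 2 * ‖w‖ := by
      have hconv := convex_closedBall z (2 * ‖w‖)
      have hm : z' ∈ closedBall z (2 * ‖w‖) := by
        have hqm : q ∈ closedBall z (2 * ‖w‖) := by rwa [mem_closedBall_iff_norm]
        rcases hz' with h | h
        · exact hconv.segment_subset (mem_closedBall_self (by positivity)) hqm h
        · refine hconv.segment_subset ?_ hqm h
          rw [mem_closedBall_iff_norm]; simp; linarith
      rwa [mem_closedBall_iff_norm] at hm
    obtain ⟨hz'S, hsum⟩ := hq z' hz'
    have hz'R : z' ∈ ball (0 : ℂ) R := by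
      rw [mem_ball_zero_iff]
      have : ‖z'‖ ≤ ‖z‖ + ‖z' - z‖ := by
        calc ‖z'‖ = ‖z + (z' - z)‖ := by ring_nf
          _ ≤ _ := norm_add_le _ _
      linarith
    obtain ⟨h1, h2, h3⟩ := hfS z' hz'R hz'S
    refine ⟨h1, ?_⟩
    have hlog : Real.log ‖g z'‖ - Real.log ‖g z‖ ≤ Ψ := by
      have := log_sub_log_le_of_poissonJensen hα hα'.le hu hci hS' d hz hz'R hzS hz'S hdist
        (by linarith)
      simp only [hg]
      rw [h3, hz3]
      refine this.trans ?_
      have e1 : ∑ i ∈ S, |d i| * ‖z - i‖ ^ (-α) ≤ W :=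
        Finset.sum_le_sum fun i _ ↦ by
          gcongr; exact le_add_of_nonneg_right (by positivity)
      have e2 : (2 * ‖w‖) ^ α = 2 ^ α * ‖w‖ ^ α := Real.mul_rpow (by norm_num) hw'.le
      have e3 : 2 * (2 ^ α * ‖w‖ ^ α / α) * (∑ i ∈ S, |d i| * ‖z - i‖ ^ (-α) +
          ∑ i ∈ S, |d i| * ‖z' - i‖ ^ (-α)) ≤ 2 * (2 ^ α * ‖w‖ ^ α / α) * (W + C * W) := by
        gcongr
      rw [e2, hΨ]
      calc _ ≤ 4 * (2 * ‖w‖) / (R - ‖z‖) * poissonAbs u R z +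
            2 * (2 ^ α * ‖w‖ ^ α / α) * (W + C * W) := by gcongr
        _ = _ := by ring
    have p1 : 0 < ‖g z'‖ := norm_pos_iff.2 h2
    have p2 : 0 < ‖g z‖ := norm_pos_iff.2 hz2
    rw [← Real.log_le_log_iff p1 (by positivity), Real.log_mul p2.ne' (Real.exp_ne_zero _),
      Real.log_exp]
    linarith
  set h : ℂ → ℂ := fun z ↦ f z - a * z with hh
  have hseg : ∀ p : ℂ, segment ℝ p q ⊆ segment ℝ z q ∪ segment ℝ (z + w) q →
      ‖h q - h p‖ ≤ ‖g z‖ * Real.exp Ψ * ‖q - p‖ := by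
    intro p hp
    refine Convex.norm_image_sub_le_of_norm_hasDerivWithin_le (f' := g) (s := segment ℝ p q)
      (fun x hx ↦ ?_) (fun x hx ↦ (key x (hp hx)).2) (convex_segment p q)
      (left_mem_segment ℝ p q) (right_mem_segment ℝ p q)
    have h1 := ((key x (hp hx)).1.differentiableAt.hasDerivAt).sub
      ((hasDerivAt_id x).const_mul a)
    simp only [mul_one] at h1
    exact h1.hasDerivWithinAt
  have b1 := hseg z subset_union_left
  have b2 := hseg (z + w) subset_union_right
  have p2 : 0 < ‖g z‖ := norm_pos_iff.2 hz2
  have hnum : ‖f (z + w) - f z - a * w‖ ≤ 4 * ‖w‖ * (‖g z‖ * Real.exp Ψ) := by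
    have e : f (z + w) - f z - a * w = (h q - h z) - (h q - h (z + w)) := by
      simp only [hh]; ring
    rw [e]
    have hK : 0 < ‖g z‖ * Real.exp Ψ := by positivity
    calc _ ≤ ‖h q - h z‖ + ‖h q - h (z + w)‖ := norm_sub_le _ _
      _ ≤ ‖g z‖ * Real.exp Ψ * (2 * ‖w‖) + ‖g z‖ * Real.exp Ψ * (2 * ‖w‖) := by
          refine add_le_add (b1.trans ?_) (b2.trans ?_) <;> gcongr
      _ = _ := by ring
  have hq' : ‖VarShift.shiftQuotient f a w z‖ ≤ 4 * ‖w‖ * Real.exp Ψ := by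
    rw [VarShift.shiftQuotient, norm_div, div_le_iff₀ p2]
    calc _ ≤ _ := hnum
      _ = _ := by simp only [hg]; ring
  calc Real.posLog ‖VarShift.shiftQuotient f a w z‖ ≤ Real.posLog (4 * ‖w‖ * Real.exp Ψ) :=
        Real.posLog_le_posLog (norm_nonneg _) hq'
    _ ≤ Real.posLog (4 * ‖w‖) + Real.posLog (Real.exp Ψ) := Real.posLog_mul
    _ = Real.posLog (4 * ‖w‖) + Ψ := by
        rw [Real.posLog_eq_log (x := Real.exp Ψ)
          (by rw [abs_of_pos (Real.exp_pos _)]; exact Real.one_le_exp hΨ0), Real.log_exp]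

lemma circleIntegrable_poissonAbs {u : ℂ → ℝ} {R r : ℝ} (hu : CircleIntegrable u 0 R)
    (hr : 0 ≤ r) (hrR : r < R) : CircleIntegrable (poissonAbs u R) 0 r :=
  ((continuousOn_poissonAbs hu).mono (fun z hz ↦ by
    rw [mem_sphere_zero_iff_norm] at hz; rw [mem_ball_zero_iff, hz]; exact hrR)).circleIntegrable hr

lemma exists_proximity_shiftQuotient_le {α : ℝ} (hα : 0 < α) (hα' : α < 1) :
    ∃ C : ℝ, 0 < C ∧ ∀ {f : ℂ → ℂ} {a w : ℂ} {r R : ℝ} {S : Finset ℂ}, Meromorphic f →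
      (∀ z, meromorphicOrderAt (fun z ↦ deriv f z - a) z ≠ ⊤) → w ≠ 0 → 0 < r →
      4 * ‖w‖ ≤ R - r →
      (∀ z ∈ sphere (0 : ℂ) R, divisor (fun z ↦ deriv f z - a) univ z = 0) →
      (∀ z, z ∈ S ↔ z ∈ ball (0 : ℂ) R ∧ z ∉ {z | AnalyticAt ℂ f z ∧ deriv f z - a ≠ 0}) →
      ValueDistribution.proximity (VarShift.shiftQuotient f a w) ⊤ r ≤
        Real.posLog (4 * ‖w‖) + 8 * ‖w‖ / (R - r) *
          (ValueDistribution.proximity (fun z ↦ deriv f z - a) ⊤ R +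
            ValueDistribution.proximity (fun z ↦ deriv f z - a)⁻¹ ⊤ R) +
        C * (‖w‖ / r) ^ α * ∑ i ∈ S, |(divisor (fun z ↦ deriv f z - a) univ i : ℝ)| := by
  obtain ⟨C₁, hC₁, hpt⟩ := exists_posLog_shiftQuotient_le hα hα'
  obtain ⟨C₂, hC₂, hmean⟩ := exists_circleAverage_norm_sub_rpow_le hα hα'
  refine ⟨C₁ * (2 * C₂), by positivity, ?_⟩
  intro f a w r R S hf hg0 hw hr hwR hsph hS
  have hw' : 0 < ‖w‖ := norm_pos_iff.2 hw
  have hrR : r < R := by linarith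
  have hR : 0 < R := by linarith
  set g : ℂ → ℂ := fun z ↦ deriv f z - a with hg
  have hgm : Meromorphic g := hf.deriv.sub (Meromorphic.const a)
  have hSb : ∀ z ∈ S, z ∈ ball (0 : ℂ) R := fun z hz ↦ ((hS z).1 hz).1
  have hgan : ∀ z, AnalyticAt ℂ f z → AnalyticAt ℂ g z := fun z hz ↦ hz.deriv.sub analyticAt_const
  obtain ⟨u, hu, hci, havg, hPJ⟩ := exists_poissonJensen hgm hg0 hR hsph (S := S)
    (fun z hz hd ↦ (hS z).2 ⟨hz, fun hA ↦ hd (divisor_eq_zero_of_ne_zero hgm (hgan z hA.1) hA.2)⟩)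
    hSb
  have hfS : ∀ z ∈ ball (0 : ℂ) R, z ∉ S → AnalyticAt ℂ f z ∧ deriv f z - a ≠ 0 ∧
      Real.log ‖deriv f z - a‖ = u z - ∑ i ∈ S, (divisor g univ i : ℝ) *
        Real.log ‖Complex.canonicalFactor R i z‖ := by
    intro z hz hzS
    have hA : AnalyticAt ℂ f z ∧ deriv f z - a ≠ 0 := by
      by_contra hn
      exact hzS ((hS z).2 ⟨hz, hn⟩)
    exact ⟨hA.1, hA.2, hPJ z hz (hgan z hA.1) hA.2⟩
  set k : ℂ → ℝ := fun i ↦ |(divisor g univ i : ℝ)| with hk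
  -- The potential at z + w is a potential at z with the pole moved to i - w, so the same circle
  -- mean applies.
  have hshift : ∀ i : ℂ, (fun z : ℂ ↦ ‖z + w - i‖ ^ (-α)) = fun z ↦ ‖z - (i - w)‖ ^ (-α) := by
    intro i; funext z; congr 2; ring
  have hterm : ∀ i : ℂ, CircleIntegrable (fun z ↦ k i * (‖z - i‖ ^ (-α) + ‖z + w - i‖ ^ (-α))) 0 r ∧
      Real.circleAverage (fun z ↦ k i * (‖z - i‖ ^ (-α) + ‖z + w - i‖ ^ (-α))) 0 r ≤
        k i * (2 * C₂ * r ^ (-α)) := by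
    intro i
    have m1 := hmean r hr i
    have m2 := hmean r hr (i - w)
    rw [← hshift i] at m2
    have hi := m1.1.add m2.1
    refine ⟨hi.const_smul (a := k i), ?_⟩
    have e := Real.circleAverage_fun_smul (a := k i) (c := 0) (R := r)
      (f := fun z ↦ ‖z - i‖ ^ (-α) + ‖z + w - i‖ ^ (-α))
    simp only [smul_eq_mul] at e
    rw [e, Real.circleAverage_fun_add m1.1 m2.1]
    gcongr
    · linarith [m1.2, m2.2]
  have hΦ := circleIntegrable_poissonAbs hci hr.le hrR
  have hsumint : CircleIntegrable
      (fun z ↦ ∑ i ∈ S, k i * (‖z - i‖ ^ (-α) + ‖z + w - i‖ ^ (-α))) 0 r :=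
    CircleIntegrable.fun_sum S fun i _ ↦ (hterm i).1
  have hΦ' : CircleIntegrable (fun z ↦ 8 * ‖w‖ / (R - r) * poissonAbs u R z) 0 r :=
    hΦ.const_smul (a := 8 * ‖w‖ / (R - r))
  have hsum' : CircleIntegrable (fun z ↦ C₁ * ‖w‖ ^ α *
      ∑ i ∈ S, k i * (‖z - i‖ ^ (-α) + ‖z + w - i‖ ^ (-α))) 0 r :=
    hsumint.const_smul (a := C₁ * ‖w‖ ^ α)
  have hadd : CircleIntegrable (fun z ↦ 8 * ‖w‖ / (R - r) * poissonAbs u R z + C₁ * ‖w‖ ^ α *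
      ∑ i ∈ S, k i * (‖z - i‖ ^ (-α) + ‖z + w - i‖ ^ (-α))) 0 r := hΦ'.add hsum'
  rw [ValueDistribution.proximity_top]
  calc Real.circleAverage (fun z ↦ Real.posLog ‖VarShift.shiftQuotient f a w z‖) 0 r
      ≤ Real.circleAverage (fun z ↦ Real.posLog (4 * ‖w‖) +
          (8 * ‖w‖ / (R - r) * poissonAbs u R z + C₁ * ‖w‖ ^ α *
            ∑ i ∈ S, k i * (‖z - i‖ ^ (-α) + ‖z + w - i‖ ^ (-α)))) 0 r := by
        apply circleAverage_mono_codiscreteWithin hr.ne'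
        · exact (meromorphic_shiftQuotient hf a w).meromorphicOn.circleIntegrable_posLog_norm
        · exact (circleIntegrable_const _ _ _).add hadd
        -- The pointwise bound may fail only on S and S - w, which is finite and invisible to the
        -- circle average.
        · have hfin : ((S : Set ℂ) ∪ ((fun z ↦ z + w) ⁻¹' (S : Set ℂ))).Finite :=
            S.finite_toSet.union (S.finite_toSet.preimage (add_left_injective w).injOn)
          filter_upwards [codiscreteWithin_mono (subset_univ _) hfin.compl_mem_codiscrete,
            self_mem_codiscreteWithin _] with z h1 h2
          rw [abs_of_pos hr, mem_sphere_zero_iff_norm] at h2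
          have := hpt hw hu hci hSb hfS z (by rw [h2]; exact hwR) (fun h ↦ h1 (Or.inl h))
            (fun h ↦ h1 (Or.inr h))
          rwa [h2] at this
    _ = Real.posLog (4 * ‖w‖) + (8 * ‖w‖ / (R - r) * Real.circleAverage (poissonAbs u R) 0 r +
          C₁ * ‖w‖ ^ α * ∑ i ∈ S, Real.circleAverage
            (fun z ↦ k i * (‖z - i‖ ^ (-α) + ‖z + w - i‖ ^ (-α))) 0 r) := by
        rw [Real.circleAverage_fun_add (circleIntegrable_const _ _ _) hadd,
          Real.circleAverage_fun_add hΦ' hsum', Real.circleAverage_const]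
        have e1 := Real.circleAverage_fun_smul (a := 8 * ‖w‖ / (R - r)) (c := 0) (R := r)
          (f := poissonAbs u R)
        have e2 := Real.circleAverage_fun_smul (a := C₁ * ‖w‖ ^ α) (c := 0) (R := r)
          (f := fun z ↦ ∑ i ∈ S, k i * (‖z - i‖ ^ (-α) + ‖z + w - i‖ ^ (-α)))
        simp only [smul_eq_mul] at e1 e2
        rw [e1, e2, Real.circleAverage_fun_sum fun i _ ↦ (hterm i).1]
    _ ≤ Real.posLog (4 * ‖w‖) + (8 * ‖w‖ / (R - r) *
          (ValueDistribution.proximity g ⊤ R + ValueDistribution.proximity g⁻¹ ⊤ R) +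
          C₁ * ‖w‖ ^ α * ∑ i ∈ S, k i * (2 * C₂ * r ^ (-α))) := by
        rw [circleAverage_poissonAbs hci hr.le hrR, havg]
        gcongr with i hi
        exact (hterm i).2
    _ = _ := by
        rw [← Finset.sum_mul, Real.div_rpow hw'.le hr.le, Real.rpow_neg hr.le]
        ring

/-! ### Bounds in terms of the characteristic of f' -/

lemma exists_characteristic_sub_const_le {G : ℂ → ℂ} (hG : Meromorphic G) (a : ℂ) :
    ∃ C : ℝ, 0 < C ∧ ∀ r, ValueDistribution.characteristic (fun z ↦ G z - a) ⊤ r ≤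
        ValueDistribution.characteristic G ⊤ r + C ∧
      ValueDistribution.characteristic (fun z ↦ G z - a)⁻¹ ⊤ r ≤
        ValueDistribution.characteristic G ⊤ r + C := by
  have hg : Meromorphic fun z ↦ G z - a := hG.sub (Meromorphic.const a)
  refine ⟨Real.posLog ‖a‖ + Real.log 2 + max |Real.log ‖G 0 - a‖|
    |Real.log ‖meromorphicTrailingCoeffAt (fun z ↦ G z - a) 0‖|, ?_, fun r ↦ ?_⟩
  · have h1 : 0 < Real.log 2 := Real.log_pos (by norm_num)
    have h2 := Real.posLog_nonneg (x := ‖a‖)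
    have h3 : 0 ≤ max |Real.log ‖G 0 - a‖|
      |Real.log ‖meromorphicTrailingCoeffAt (fun z ↦ G z - a) 0‖| := le_max_of_le_left (abs_nonneg _)
    positivity
  · have h1 := abs_le.1
      (ValueDistribution.abs_characteristic_sub_characteristic_shift_le (a₀ := a) (r := r) hG)
    have h2 := abs_le.1 (ValueDistribution.characteristic_sub_characteristic_inv_le (R := r) hg)
    have h3 : 0 ≤ max |Real.log ‖G 0 - a‖|
      |Real.log ‖meromorphicTrailingCoeffAt (fun z ↦ G z - a) 0‖| := le_max_of_le_left (abs_nonneg _)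
    constructor <;> linarith [h1.1, h2.2]

lemma proximity_le_characteristic {g : ℂ → ℂ} {r : ℝ} (hr : 1 ≤ r) :
    ValueDistribution.proximity g ⊤ r ≤ ValueDistribution.characteristic g ⊤ r := by
  have := ValueDistribution.logCounting_nonneg (f := g) (e := ⊤) hr
  simp only [ValueDistribution.characteristic, Pi.add_apply]
  linarith

lemma logCounting_le_characteristic {g : ℂ → ℂ} {r : ℝ} :
    ValueDistribution.logCounting g ⊤ r ≤ ValueDistribution.characteristic g ⊤ r := by
  have := ValueDistribution.proximity_nonneg (f := g) (a := ⊤) r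
  simp only [ValueDistribution.characteristic, Pi.add_apply, Pi.zero_apply] at this ⊢
  linarith

lemma div_le_log_div {R R' : ℝ} (hR : 0 < R) (hR' : 0 < R') : (R' - R) / R' ≤ Real.log (R' / R) := by
  have := Real.one_sub_inv_le_log_of_pos (div_pos hR' hR)
  rw [inv_div] at this
  rwa [sub_div, div_self hR'.ne']

lemma exists_proximity_shiftQuotient_le_characteristic {f : ℂ → ℂ} {a : ℂ} (hf : Meromorphic f)
    (hg0 : ∀ z, meromorphicOrderAt (fun z ↦ deriv f z - a) z ≠ ⊤) {α : ℝ} (hα : 0 < α)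
    (hα' : α < 1) : ∃ C : ℝ, 0 < C ∧ ∀ (r h : ℝ) (w : ℂ), 1 ≤ r → 0 < h → w ≠ 0 →
      8 * ‖w‖ ≤ h → ValueDistribution.proximity (VarShift.shiftQuotient f a w) ⊤ r ≤
        Real.posLog (4 * ‖w‖) + C * (‖w‖ / h + (‖w‖ / r) ^ α * ((r + h) / h)) *
          (ValueDistribution.characteristic (deriv f) ⊤ (r + h) + 1) := by
  obtain ⟨C₁, hC₁, hbd⟩ := exists_proximity_shiftQuotient_le hα hα'
  obtain ⟨C₂, hC₂, hT⟩ := exists_characteristic_sub_const_le hf.deriv a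
  set g : ℂ → ℂ := fun z ↦ deriv f z - a with hg
  have hgm : Meromorphic g := hf.deriv.sub (Meromorphic.const a)
  set D : ℝ := max C₂ 1 with hD
  have hD1 : 1 ≤ D := le_max_right _ _
  have hDC : C₂ ≤ D := le_max_left _ _
  refine ⟨32 * D + 8 * C₁ * D, by positivity, fun r h w hr hh hw hwh ↦ ?_⟩
  have hw' : 0 < ‖w‖ := norm_pos_iff.2 hw
  -- The radius leaves a gap of order h on both sides: R - r ≥ h/2 ≥ 4|w| serves the Poisson term,
  -- and r + h - R ≥ h/4 serves the count of zeros and poles.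
  obtain ⟨R, ⟨hR1, hR2⟩, hsph⟩ := exists_radius_divisor_eq_zero (divisor g univ)
    (a := r + h / 2) (b := r + 3 * h / 4) (by linarith)
  have hA : {z | AnalyticAt ℂ f z ∧ deriv f z - a ≠ 0} ∈ codiscrete ℂ :=
    Filter.inter_mem (hf.meromorphicOn.analyticAt_mem_codiscreteWithin (U := univ))
      (hgm.meromorphicOn.eventually_codiscreteWithin_apply_ne_zero fun z _ ↦ hg0 z)
  obtain ⟨S, hS⟩ := exists_finset_mem_iff hA R
  have key := hbd hf hg0 hw (r := r) (by linarith) (R := R) (by linarith) hsph hS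
  set T : ℝ := ValueDistribution.characteristic (deriv f) ⊤ (r + h) with hTdef
  have hT0 : 0 ≤ T := ValueDistribution.characteristic_nonneg (by linarith)
  have hmono : ValueDistribution.characteristic (deriv f) ⊤ R ≤ T :=
    ValueDistribution.characteristic_monotoneOn hf.deriv (mem_Ioi.2 (by linarith))
      (mem_Ioi.2 (by linarith)) (by linarith)
  have hprox : ValueDistribution.proximity g ⊤ R + ValueDistribution.proximity g⁻¹ ⊤ R ≤
      2 * D * (T + 1) := by
    have h1 := proximity_le_characteristic (g := g) (r := R) (by linarith)
    have h2 := proximity_le_characteristic (g := g⁻¹) (r := R) (by linarith)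
    have h3 := hT R
    nlinarith [h3.1, h3.2]
  have hcount : ∑ i ∈ S, |(divisor g univ i : ℝ)| ≤ 8 * D * ((r + h) / h) * (T + 1) := by
    have h1 := sum_abs_divisor_mul_log_le g (R := R) (R' := r + h) (by linarith) (by linarith)
      (S := S) (fun z hz ↦ (mem_ball_zero_iff.1 ((hS z).1 hz).1).le)
    have h2 := logCounting_le_characteristic (g := g) (r := r + h)
    have h3 := logCounting_le_characteristic (g := g⁻¹) (r := r + h)
    have h4 := hT (r + h)
    have h5 : h / (4 * (r + h)) ≤ Real.log ((r + h) / R) := by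
      refine le_trans ?_ (div_le_log_div (by linarith) (by linarith))
      rw [div_le_div_iff₀ (by linarith) (by linarith)]
      nlinarith
    have h6 : 0 ≤ ∑ i ∈ S, |(divisor g univ i : ℝ)| := Finset.sum_nonneg fun i _ ↦ abs_nonneg _
    have h7 : (∑ i ∈ S, |(divisor g univ i : ℝ)|) * (h / (4 * (r + h))) ≤ 2 * D * (T + 1) := by
      have := mul_le_mul_of_nonneg_left h5 h6
      nlinarith [h4.1, h4.2]
    rw [← mul_div_assoc, div_le_iff₀ (by positivity)] at h7
    rw [mul_div_assoc', div_mul_eq_mul_div, le_div_iff₀ hh]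
    linarith
  have e1 : 8 * ‖w‖ / (R - r) ≤ 16 * (‖w‖ / h) := by
    rw [← mul_div_assoc, div_le_div_iff₀ (by linarith) hh]
    nlinarith
  have e2 : 0 ≤ ValueDistribution.proximity g ⊤ R + ValueDistribution.proximity g⁻¹ ⊤ R :=
    add_nonneg (ValueDistribution.proximity_nonneg R) (ValueDistribution.proximity_nonneg R)
  have e3 := mul_le_mul e1 hprox e2 (by positivity)
  have e4 := mul_le_mul_of_nonneg_left hcount
    (show 0 ≤ C₁ * (‖w‖ / r) ^ α by have : 0 ≤ ‖w‖ / r := by positivity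
                                    positivity)
  have e5 : 0 ≤ (‖w‖ / r) ^ α := by positivity
  have e6 : 0 ≤ (r + h) / h := by positivity
  have e7 : 0 ≤ ‖w‖ / h := by positivity
  calc _ ≤ _ := key
    _ ≤ Real.posLog (4 * ‖w‖) + 16 * (‖w‖ / h) * (2 * D * (T + 1)) +
        C₁ * (‖w‖ / r) ^ α * (8 * D * ((r + h) / h) * (T + 1)) := by gcongr
    _ ≤ Real.posLog (4 * ‖w‖) + 16 * (‖w‖ / h) * (2 * D * (T + 1)) +
        C₁ * (‖w‖ / r) ^ α * (8 * D * ((r + h) / h) * (T + 1)) +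
        (8 * C₁ * D * (‖w‖ / h) * (T + 1) + 32 * D * ((‖w‖ / r) ^ α * ((r + h) / h)) * (T + 1)) :=
        le_add_of_nonneg_right (by positivity)
    _ = _ := by ring

/-! ### A growth lemma for increasing functions -/

/-- Chebyshev's inequality together with telescoping: the integral of u(x+h) - u(x) over [a, b] is
the integral of u over [b, b+h] minus that over [a, a+h]. -/
lemma mul_volume_real_le_of_monotone {u : ℝ → ℝ} (hu : Monotone u) (h0 : ∀ x, 0 ≤ u x)
    {a b h δ : ℝ} (hab : a ≤ b) (hh : 0 ≤ h) :
    δ * volume.real ({x | δ ≤ u (x + h) - u x} ∩ Icc a b) ≤ h * u (b + h) := by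
  have hu' : Monotone fun x ↦ u (x + h) := fun x y hxy ↦ hu (by linarith)
  have hi : ∀ c d, IntervalIntegrable u volume c d := fun c d ↦ hu.intervalIntegrable
  have hint : IntegrableOn (fun x ↦ u (x + h) - u x) (Icc a b) := by
    rw [integrableOn_Icc_iff_integrableOn_Ioc, ← intervalIntegrable_iff_integrableOn_Ioc_of_le hab]
    exact hu'.intervalIntegrable.sub (hi a b)
  have hmeas : MeasurableSet {x | δ ≤ u (x + h) - u x} :=
    measurableSet_le measurable_const (hu'.measurable.sub hu.measurable)
  have h1 := mul_meas_ge_le_integral_of_nonneg (μ := volume.restrict (Icc a b))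
    (ae_of_all _ fun x ↦ sub_nonneg.2 (hu (by linarith : x ≤ x + h))) hint δ
  rw [measureReal_restrict_apply hmeas] at h1
  refine h1.trans ?_
  rw [integral_Icc_eq_integral_Ioc, ← intervalIntegral.integral_of_le hab,
    intervalIntegral.integral_sub hu'.intervalIntegrable (hi a b),
    intervalIntegral.integral_comp_add_right,
    intervalIntegral.integral_interval_sub_interval_comm (hi _ _) (hi _ _) (hi _ _)]
  have h2 : 0 ≤ ∫ x in a..a + h, u x :=
    intervalIntegral.integral_nonneg (by linarith) fun x _ ↦ h0 x
  have h3 : ∫ x in b..b + h, u x ≤ ∫ _ in b..b + h, u (b + h) :=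
    intervalIntegral.integral_mono_on (by linarith) (hi _ _) intervalIntegrable_const
      fun x hx ↦ hu hx.2
  rw [intervalIntegral.integral_const, smul_eq_mul] at h3
  rw [intervalIntegral.integral_symm a (a + h), intervalIntegral.integral_symm b (b + h)]
  linarith

/-- On a dyadic block ending at b the step is enlarged to the constant b^(1-σ). Exceptional points
then fill length O(b^(1-σ+s)), and dividing by the left end 2^k gives a geometric term of ratio
2^(s-σ), summable exactly when s < σ. -/
lemma lintegral_one_div_le_of_monotone {u : ℝ → ℝ} (hu : Monotone u) (h0 : ∀ x, 0 ≤ u x)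
    {s σ C δ : ℝ} (hσ : 0 ≤ σ) (hσ1 : σ < 1) (hδ : 0 < δ)
    (hb : ∀ r, 1 ≤ r → u r ≤ C * r ^ s) (k : ℕ) :
    ∫⁻ t in {r | δ < u (r + r ^ (1 - σ)) - u r} ∩ Icc (2 ^ k) (2 ^ (k + 1)),
      ENNReal.ofReal (1 / t) ≤ ENNReal.ofReal (C / δ * 2 ^ (1 - σ + 2 * s) * (2 ^ (s - σ)) ^ k) := by
  set a : ℝ := 2 ^ k with ha
  set b : ℝ := 2 ^ (k + 1) with hb'
  have ha1 : 1 ≤ a := one_le_pow₀ (by norm_num)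
  have hba : b = 2 * a := by rw [hb', ha, pow_succ]; ring
  set h : ℝ := b ^ (1 - σ) with hh
  have hb1 : 1 ≤ b := by linarith
  have hhb : h ≤ b := by
    calc h ≤ b ^ (1 : ℝ) := Real.rpow_le_rpow_of_exponent_le hb1 (by linarith)
      _ = b := Real.rpow_one b
  have hh0 : 0 ≤ h := by positivity
  have hsub : {r | δ < u (r + r ^ (1 - σ)) - u r} ∩ Icc a b ⊆
      {x | δ ≤ u (x + h) - u x} ∩ Icc a b := by
    rintro x ⟨hx, hxI⟩
    refine ⟨?_, hxI⟩
    have hx' : δ < u (x + x ^ (1 - σ)) - u x := hx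
    have : u (x + x ^ (1 - σ)) ≤ u (x + h) := hu (by
      have := Real.rpow_le_rpow (by linarith [hxI.1]) hxI.2 (by linarith : 0 ≤ 1 - σ)
      linarith)
    change δ ≤ u (x + h) - u x
    linarith
  have hu' : Monotone fun x ↦ u (x + h) := fun x y hxy ↦ hu (by linarith)
  have hmeas : MeasurableSet ({x | δ ≤ u (x + h) - u x} ∩ Icc a b) :=
    (measurableSet_le measurable_const (hu'.measurable.sub hu.measurable)).inter measurableSet_Icc
  have hvol := mul_volume_real_le_of_monotone hu h0 (δ := δ) (show a ≤ b by linarith) hh0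
  set A := {x | δ ≤ u (x + h) - u x} ∩ Icc a b with hA
  have hAfin : volume A ≠ ⊤ :=
    ne_top_of_le_ne_top (by simp) (measure_mono (inter_subset_right : A ⊆ Icc a b))
  calc _ ≤ ∫⁻ t in A, ENNReal.ofReal (1 / t) := lintegral_mono_set hsub
    _ ≤ ∫⁻ _ in A, ENNReal.ofReal (1 / a) := by
        apply setLIntegral_mono' hmeas
        intro t ht
        apply ENNReal.ofReal_le_ofReal
        have := ht.2.1
        gcongr
    _ = ENNReal.ofReal (1 / a * volume.real A) := by
        rw [setLIntegral_const, ENNReal.ofReal_mul (by positivity), Measure.real,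
          ENNReal.ofReal_toReal hAfin]
    _ ≤ _ := by
        apply ENNReal.ofReal_le_ofReal
        have h1 : u (b + h) ≤ C * (2 * b) ^ s := (hu (by linarith)).trans (hb _ (by linarith))
        have h2 : volume.real A ≤ h * (C * (2 * b) ^ s) / δ := by
          rw [le_div_iff₀ hδ, mul_comm]
          exact hvol.trans (mul_le_mul_of_nonneg_left h1 hh0)
        calc 1 / a * volume.real A ≤ 1 / a * (h * (C * (2 * b) ^ s) / δ) := by gcongr
          _ = C / δ * (a⁻¹ * b ^ (1 - σ) * (2 * b) ^ s) := by rw [hh]; field_simp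
          _ = _ := by
            have ea : a = (2 : ℝ) ^ (k : ℝ) := by rw [Real.rpow_natCast]
            rw [hba, ea, ← Real.rpow_natCast (2 ^ (s - σ)) k, ← Real.rpow_mul (by norm_num),
              ← Real.rpow_neg (by norm_num), mul_assoc (C / δ),
              ← Real.rpow_add (by norm_num)]
            congr 1
            have e1 : (2 : ℝ) * 2 ^ (k : ℝ) = 2 ^ (1 + k : ℝ) := by
              rw [Real.rpow_add (by norm_num), Real.rpow_one]
            have e2 : (2 : ℝ) * 2 ^ (1 + k : ℝ) = 2 ^ (2 + k : ℝ) := by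
              rw [show (2 + k : ℝ) = 1 + (1 + k) by ring, Real.rpow_add (by norm_num) 1 (1 + k : ℝ),
                Real.rpow_one]
            rw [e1, e2, ← Real.rpow_mul (by norm_num), ← Real.rpow_mul (by norm_num),
              ← Real.rpow_add (by norm_num), ← Real.rpow_add (by norm_num)]
            congr 1
            ring

lemma finiteLogMeasure_of_monotone {u : ℝ → ℝ} (hu : Monotone u) (h0 : ∀ x, 0 ≤ u x)
    {s σ C δ : ℝ} (hs : 0 ≤ s) (hsσ : s < σ) (hσ1 : σ < 1) (hδ : 0 < δ)
    (hb : ∀ r, 1 ≤ r → u r ≤ C * r ^ s) :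
    VarShift.FiniteLogMeasure ({r | δ < u (r + r ^ (1 - σ)) - u r} ∩ Ici 1) := by
  have hC : 0 ≤ C := by simpa using (h0 1).trans (hb 1 le_rfl)
  have hmeas : MeasurableSet {r | δ < u (r + r ^ (1 - σ)) - u r} :=
    measurableSet_lt measurable_const
      ((hu.measurable.comp (by fun_prop)).sub hu.measurable)
  refine ⟨fun x hx ↦ mem_Ioi.2 (lt_of_lt_of_le one_pos (mem_Ici.1 hx.2)), hmeas.inter measurableSet_Ici, ?_⟩
  have hcov : {r | δ < u (r + r ^ (1 - σ)) - u r} ∩ Ici 1 ⊆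
      ⋃ k : ℕ, {r | δ < u (r + r ^ (1 - σ)) - u r} ∩ Icc (2 ^ k) (2 ^ (k + 1)) := by
    rintro x ⟨hx, hx1⟩
    obtain ⟨k, hk, hk'⟩ := exists_nat_pow_near hx1 (one_lt_two (α := ℝ))
    exact mem_iUnion.2 ⟨k, hx, hk, hk'.le⟩
  have hsum : Summable fun k : ℕ ↦ C / δ * 2 ^ (1 - σ + 2 * s) * ((2 : ℝ) ^ (s - σ)) ^ k :=
    (summable_geometric_of_lt_one (by positivity)
      (Real.rpow_lt_one_of_one_lt_of_neg one_lt_two (by linarith))).mul_left _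
  calc _ ≤ _ := lintegral_mono_set hcov
    _ ≤ _ := lintegral_iUnion_le _ _
    _ ≤ ∑' k : ℕ, ENNReal.ofReal (C / δ * 2 ^ (1 - σ + 2 * s) * ((2 : ℝ) ^ (s - σ)) ^ k) :=
        ENNReal.tsum_le_tsum fun k ↦
          lintegral_one_div_le_of_monotone hu h0 (hs.trans hsσ.le) hσ1 hδ hb k
    _ < ⊤ := hsum.tsum_ofReal_lt_top

/-! ### The characteristic of the derivative -/

lemma MeromorphicNFOn.analyticAt_or_order_neg {f : ℂ → ℂ} (hf : MeromorphicNFOn f univ) (z : ℂ) :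
    AnalyticAt ℂ f z ∨ ∃ n : ℤ, n < 0 ∧ meromorphicOrderAt f z = n := by
  rcases le_or_gt 0 (meromorphicOrderAt f z) with h | h
  · exact Or.inl ((hf (mem_univ z)).meromorphicOrderAt_nonneg_iff_analyticAt.1 h)
  · lift meromorphicOrderAt f z to ℤ using (h.trans_le le_top).ne with n hn
    exact Or.inr ⟨n, by exact_mod_cast h, rfl⟩

lemma divisor_nonneg_of_analyticAt {g : ℂ → ℂ} {z : ℂ} (h : AnalyticAt ℂ g z) :
    0 ≤ divisor g univ z := by
  by_cases hg : MeromorphicOn g univ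
  · rw [divisor_apply hg (mem_univ z)]
    exact WithTop.untop₀_nonneg.2 h.meromorphicOrderAt_nonneg
  · simp [divisor, hg]

/-- Differentiation turns a pole of order p ≥ 1 into one of order p + 1 ≤ 2p. Normal form ensures
that every point that is not a pole is a point of analyticity. -/
lemma negPart_divisor_deriv_le {f : ℂ → ℂ} (hf : MeromorphicNFOn f univ) :
    (divisor (deriv f) univ)⁻ ≤ (divisor f univ)⁻ + (divisor f univ)⁻ := by
  rw [Function.locallyFinsuppWithin.le_def, Pi.le_def]
  intro z
  rw [Function.locallyFinsuppWithin.coe_add, Pi.add_apply,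
    Function.locallyFinsuppWithin.negPart_apply, Function.locallyFinsuppWithin.negPart_apply]
  rcases MeromorphicNFOn.analyticAt_or_order_neg hf z with h | ⟨n, hn, h⟩
  · rw [negPart_eq_zero.2 (divisor_nonneg_of_analyticAt h.deriv)]
    have := negPart_nonneg (divisor f univ z)
    linarith
  · have h' := meromorphicOrderAt_deriv_eq_sub_one (Int.cast_ne_zero.2 hn.ne) h
    have hm : MeromorphicOn f univ := hf.meromorphicOn
    rw [divisor_apply hm (mem_univ z), divisor_apply (fun x _ ↦ (hm x (mem_univ x)).deriv)
      (mem_univ z), h, h', WithTop.untop₀_coe, WithTop.untop₀_coe, negPart_def, negPart_def]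
    rw [sup_eq_left.2 (by omega), sup_eq_left.2 (by omega)]
    omega

lemma logCounting_deriv_le {f : ℂ → ℂ} (hf : MeromorphicNFOn f univ) {r : ℝ} (hr : 1 ≤ r) :
    ValueDistribution.logCounting (deriv f) ⊤ r ≤ 2 * ValueDistribution.logCounting f ⊤ r := by
  have := Function.locallyFinsuppWithin.logCounting_le (negPart_divisor_deriv_le hf) hr
  rw [map_add, Pi.add_apply] at this
  rw [ValueDistribution.logCounting_top, ValueDistribution.logCounting_top]
  linarith

/-- Logarithms of canonical factors are nonnegative in the disc, so zeros only lower log|f| and can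
be dropped; only poles remain. -/
lemma norm_le_exp_of_poissonJensen {f : ℂ → ℂ} {u : ℂ → ℝ} {d : ℂ → ℝ} {R : ℝ} {S : Finset ℂ}
    (hS' : ∀ i ∈ S, i ∈ ball (0 : ℂ) R) {z : ℂ} (hz : z ∈ ball (0 : ℂ) R) (hzS : z ∉ S)
    (h0 : f z ≠ 0) (hPJ : Real.log ‖f z‖ = u z - ∑ i ∈ S, d i *
      Real.log ‖Complex.canonicalFactor R i z‖) :
    ‖f z‖ ≤ Real.exp (u z + ∑ i ∈ S, max (-d i) 0 * Real.log (2 * R / ‖z - i‖)) := by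
  rw [← Real.log_le_iff_le_exp (norm_pos_iff.2 h0), hPJ, sub_eq_add_neg, ← Finset.sum_neg_distrib]
  gcongr with i hi
  have hzi : z ≠ i := fun h ↦ hzS (h ▸ hi)
  have h1 := log_norm_canonicalFactor_nonneg (hS' i hi) hz hzi
  have h2 := log_norm_canonicalFactor_le (hS' i hi) hz hzi
  calc -(d i * Real.log ‖Complex.canonicalFactor R i z‖)
      = -d i * Real.log ‖Complex.canonicalFactor R i z‖ := by ring
    _ ≤ max (-d i) 0 * Real.log ‖Complex.canonicalFactor R i z‖ := by
        gcongr
        exact le_max_left _ _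
    _ ≤ _ := by gcongr

/-- Cauchy's estimate on a small circle around z, with radius half the distance to the nearest zero
or pole, capped at 1/2. This replaces the lemma on the logarithmic derivative: constant factors are
lost, but only the hyper-order has to survive. -/
lemma posLog_norm_deriv_le {f : ℂ → ℂ} {u : ℂ → ℝ} {d : ℂ → ℝ} {R : ℝ} {S : Finset ℂ}
    (hu : InnerProductSpace.HarmonicOnNhd u (closedBall 0 R)) (hci : CircleIntegrable u 0 R)
    (hS' : ∀ i ∈ S, i ∈ ball (0 : ℂ) R) (hd : ∀ i ∈ S, 1 ≤ |d i|)
    (hf : ∀ z ∈ ball (0 : ℂ) R, z ∉ S → AnalyticAt ℂ f z ∧ f z ≠ 0 ∧ Real.log ‖f z‖ =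
      u z - ∑ i ∈ S, d i * Real.log ‖Complex.canonicalFactor R i z‖)
    {z : ℂ} (hzR : ‖z‖ + 1 ≤ R) (hzS : z ∉ S) :
    Real.posLog ‖deriv f z‖ ≤ Real.log 2 + 3 * poissonAbs u R z +
      4 * (4 * R) ^ (1 / 2 : ℝ) * ∑ i ∈ S, |d i| * ‖z - i‖ ^ (-(1 / 2) : ℝ) := by
  have hz : z ∈ ball (0 : ℂ) R := by rw [mem_ball_zero_iff]; linarith
  have hR : 1 ≤ R := by linarith [norm_nonneg z]
  have hP := poissonAbs_nonneg u hz
  have hpos : ∀ i ∈ S, 0 < ‖z - i‖ := fun i hi ↦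
    norm_pos_iff.2 (sub_ne_zero.2 fun h ↦ hzS (h ▸ hi))
  have hlt : ∀ i ∈ S, ‖z - i‖ ≤ 2 * R := fun i hi ↦ by
    have h1 := mem_ball_zero_iff.1 (hS' i hi)
    linarith [norm_sub_le z i]
  set L : ℂ → ℝ := fun i ↦ |d i| * Real.log (4 * R / ‖z - i‖) with hL
  have hlog : ∀ i ∈ S, 0 ≤ Real.log (4 * R / ‖z - i‖) := fun i hi ↦ by
    apply Real.log_nonneg
    rw [le_div_iff₀ (hpos i hi)]
    linarith [hlt i hi]
  have hL0 : ∀ i ∈ S, 0 ≤ L i := fun i hi ↦ mul_nonneg (abs_nonneg _) (hlog i hi)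
  -- Because |d j| ≥ 1 at the nearest point j, the cost log(1/δ) is absorbed by the single term `L
  -- j`, up to log 2.
  have hδ : ∃ δ : ℝ, 0 < δ ∧ δ ≤ 1 / 2 ∧ (∀ i ∈ S, δ ≤ ‖z - i‖ / 2) ∧
      Real.log δ⁻¹ ≤ Real.log 2 + ∑ i ∈ S, L i := by
    rcases S.eq_empty_or_nonempty with rfl | hne
    · exact ⟨1 / 2, by norm_num, le_rfl, by simp, by norm_num⟩
    obtain ⟨j, hj, hjmin⟩ := S.exists_min_image (fun i ↦ ‖z - i‖) hne
    have hj0 := hpos j hj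
    have hLj : L j ≤ ∑ i ∈ S, L i := Finset.single_le_sum hL0 hj
    have hl2 : 0 ≤ Real.log 2 := Real.log_nonneg (by norm_num)
    refine ⟨min 1 ‖z - j‖ / 2, by positivity, ?_, fun i hi ↦ ?_, ?_⟩
    · linarith [min_le_left 1 ‖z - j‖]
    · linarith [min_le_right 1 ‖z - j‖, hjmin i hi]
    · rw [inv_div, Real.log_div (by norm_num) (by positivity)]
      rcases le_total 1 ‖z - j‖ with h | h
      · rw [min_eq_left h, Real.log_one]
        linarith [hL0 j hj]
      · rw [min_eq_right h]
        have h1 : Real.log (4 * R / ‖z - j‖) ≤ L j :=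
          le_mul_of_one_le_left (hlog j hj) (hd j hj)
        rw [Real.log_div (by positivity) hj0.ne'] at h1
        have h2 : 0 ≤ Real.log (4 * R) := Real.log_nonneg (by linarith)
        linarith
  obtain ⟨δ, hδ0, hδ1, hδS, hδlog⟩ := hδ
  have hball : ∀ ζ ∈ closedBall z δ, ζ ∈ ball (0 : ℂ) R ∧ ζ ∉ S ∧ ‖ζ - z‖ ≤ δ := by
    intro ζ hζ
    rw [mem_closedBall, dist_eq_norm] at hζ
    refine ⟨?_, fun hS ↦ ?_, hζ⟩
    · rw [mem_ball_zero_iff]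
      have := norm_add_le (ζ - z) z
      rw [sub_add_cancel] at this
      linarith
    · have := hδS ζ hS
      rw [norm_sub_rev] at this
      have h2 : 0 < ‖ζ - z‖ := by rw [norm_sub_rev]; exact hpos ζ hS
      linarith
  have hM : ∀ ζ ∈ sphere z δ, ‖f ζ‖ ≤ Real.exp (3 * poissonAbs u R z + ∑ i ∈ S, L i) := by
    intro ζ hζ
    obtain ⟨h1, h2, h3⟩ := hball ζ (sphere_subset_closedBall hζ)
    refine (norm_le_exp_of_poissonJensen hS' h1 h2 (hf ζ h1 h2).2.1 (hf ζ h1 h2).2.2).trans ?_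
    apply Real.exp_le_exp.2
    have h4 := sub_le_poissonAbs hu hci hz (w' := ζ) (by linarith)
    have h5 := le_poissonAbs hu hci hz
    have h6 : 4 * ‖ζ - z‖ / (R - ‖z‖) ≤ 2 := by
      rw [div_le_iff₀ (by linarith)]
      linarith
    have h7 := mul_le_mul_of_nonneg_right h6 hP
    have h8 : ∑ i ∈ S, max (-d i) 0 * Real.log (2 * R / ‖ζ - i‖) ≤ ∑ i ∈ S, L i := by
      apply Finset.sum_le_sum
      intro i hi
      have h9 : ‖z - i‖ / 2 ≤ ‖ζ - i‖ := by
        have := norm_sub_le_norm_sub_add_norm_sub z ζ i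
        rw [norm_sub_rev z ζ] at this
        linarith [hδS i hi]
      have h10 := hpos i hi
      simp only [hL]
      refine (mul_le_mul_of_nonneg_left (Real.log_le_log (y := 4 * R / ‖z - i‖) ?_ ?_)
        (le_max_right _ _)).trans (mul_le_mul_of_nonneg_right
          (max_le (neg_le_abs _) (abs_nonneg _)) (hlog i hi))
      · exact div_pos (by positivity) (by linarith)
      · rw [div_le_div_iff₀ (by linarith) h10]
        nlinarith
    linarith
  have hdiff : DiffContOnCl ℂ f (ball z δ) := by
    apply DifferentiableOn.diffContOnCl
    rw [closure_ball z hδ0.ne']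
    exact fun ζ hζ ↦ (hf ζ (hball ζ hζ).1 (hball ζ hζ).2.1).1.differentiableAt.differentiableWithinAt
  have hC := Complex.norm_deriv_le_of_forall_mem_sphere_norm_le hδ0 hdiff hM
  have hsum0 : 0 ≤ ∑ i ∈ S, L i := Finset.sum_nonneg hL0
  have hl2 : 0 ≤ Real.log 2 := Real.log_nonneg (by norm_num)
  have hsumle : ∑ i ∈ S, L i ≤
      2 * (4 * R) ^ (1 / 2 : ℝ) * ∑ i ∈ S, |d i| * ‖z - i‖ ^ (-(1 / 2) : ℝ) := by
    rw [Finset.mul_sum]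
    apply Finset.sum_le_sum
    intro i hi
    have h10 := hpos i hi
    have h11 := Real.log_le_rpow_div (x := 4 * R / ‖z - i‖) (by positivity)
      (show (0 : ℝ) < 1 / 2 by norm_num)
    rw [Real.div_rpow (by positivity) h10.le, div_div_eq_mul_div, div_one] at h11
    calc L i ≤ |d i| * ((4 * R) ^ (1 / 2 : ℝ) / ‖z - i‖ ^ (1 / 2 : ℝ) * 2) := by
          simp only [hL]; gcongr
      _ = _ := by rw [Real.rpow_neg h10.le]; ring
  have hposlog : Real.posLog ‖deriv f z‖ ≤
      Real.log 2 + 3 * poissonAbs u R z + 2 * ∑ i ∈ S, L i := by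
    rw [Real.posLog_def]
    apply max_le (by positivity)
    by_cases h0 : ‖deriv f z‖ = 0
    · simp only [h0, Real.log_zero]; positivity
    have := Real.log_le_log (lt_of_le_of_ne (norm_nonneg _) (Ne.symm h0)) hC
    rw [div_eq_mul_inv, Real.log_mul (Real.exp_pos _).ne' (by positivity), Real.log_exp] at this
    linarith
  linarith

lemma exists_proximity_deriv_le : ∃ C : ℝ, 0 < C ∧ ∀ {f : ℂ → ℂ} {r R : ℝ} {S : Finset ℂ},
    MeromorphicNFOn f univ → (∀ z, meromorphicOrderAt f z ≠ ⊤) → 1 ≤ r → r + 1 ≤ R →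
      (∀ z ∈ sphere (0 : ℂ) R, divisor f univ z = 0) →
      (∀ z, z ∈ S ↔ z ∈ ball (0 : ℂ) R ∧ divisor f univ z ≠ 0) →
      ValueDistribution.proximity (deriv f) ⊤ r ≤ Real.log 2 +
        3 * (ValueDistribution.proximity f ⊤ R + ValueDistribution.proximity f⁻¹ ⊤ R) +
        C * (R / r) ^ (1 / 2 : ℝ) * ∑ i ∈ S, |(divisor f univ i : ℝ)| := by
  obtain ⟨C, hC, hmean⟩ := exists_circleAverage_norm_sub_rpow_le
    (show (0 : ℝ) < 1 / 2 by norm_num) (by norm_num)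
  refine ⟨4 * 4 ^ (1 / 2 : ℝ) * C, by positivity, ?_⟩
  intro f r R S hf hf0 hr hrR hsph hS
  have hm : Meromorphic f := fun z ↦ hf.meromorphicOn z (mem_univ z)
  have hr0 : 0 < r := by linarith
  obtain ⟨u, hu, hci, havg, hPJ⟩ := exists_poissonJensen hm hf0 (by linarith) hsph (S := S)
    (fun z hz hd ↦ (hS z).2 ⟨hz, hd⟩) (fun z hz ↦ ((hS z).1 hz).1)
  set d : ℂ → ℝ := fun i ↦ (divisor f univ i : ℝ) with hd
  have hfS : ∀ z ∈ ball (0 : ℂ) R, z ∉ S → AnalyticAt ℂ f z ∧ f z ≠ 0 ∧ Real.log ‖f z‖ =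
      u z - ∑ i ∈ S, d i * Real.log ‖Complex.canonicalFactor R i z‖ := by
    intro z hz hzS
    have h0 : divisor f univ z = 0 := by
      by_contra h
      exact hzS ((hS z).2 ⟨hz, h⟩)
    rw [divisor_apply hm.meromorphicOn (mem_univ z), WithTop.untop₀_eq_zero] at h0
    have h0' := h0.resolve_right (hf0 z)
    have h1 := (hf (mem_univ z)).meromorphicOrderAt_nonneg_iff_analyticAt.1 h0'.ge
    have h2 := (hf (mem_univ z)).meromorphicOrderAt_eq_zero_iff.1 h0'
    exact ⟨h1, h2, hPJ z hz h1 h2⟩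
  have hd1 : ∀ i ∈ S, 1 ≤ |d i| := fun i hi ↦ by
    have := Int.one_le_abs ((hS i).1 hi).2
    simp only [hd]
    exact_mod_cast this
  have hS' : ∀ i ∈ S, i ∈ ball (0 : ℂ) R := fun i hi ↦ ((hS i).1 hi).1
  have hterm : ∀ i : ℂ, CircleIntegrable (fun z ↦ |d i| * ‖z - i‖ ^ (-(1 / 2) : ℝ)) 0 r ∧
      Real.circleAverage (fun z ↦ |d i| * ‖z - i‖ ^ (-(1 / 2) : ℝ)) 0 r ≤
        |d i| * (C * r ^ (-(1 / 2) : ℝ)) := by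
    intro i
    have m1 := hmean r hr0 i
    refine ⟨m1.1.const_smul (a := |d i|), ?_⟩
    have e := Real.circleAverage_fun_smul (a := |d i|) (c := 0) (R := r)
      (f := fun z ↦ ‖z - i‖ ^ (-(1 / 2) : ℝ))
    simp only [smul_eq_mul] at e
    rw [e]
    gcongr
    exact m1.2
  have hΦ := circleIntegrable_poissonAbs hci hr0.le (by linarith)
  have hΦ' : CircleIntegrable (fun z ↦ 3 * poissonAbs u R z) 0 r := hΦ.const_smul (a := (3 : ℝ))
  have hsum : CircleIntegrable (fun z ↦ ∑ i ∈ S, |d i| * ‖z - i‖ ^ (-(1 / 2) : ℝ)) 0 r :=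
    CircleIntegrable.fun_sum S fun i _ ↦ (hterm i).1
  have hsum' : CircleIntegrable (fun z ↦ 4 * (4 * R) ^ (1 / 2 : ℝ) *
      ∑ i ∈ S, |d i| * ‖z - i‖ ^ (-(1 / 2) : ℝ)) 0 r :=
    hsum.const_smul (a := 4 * (4 * R) ^ (1 / 2 : ℝ))
  have hadd : CircleIntegrable (fun z ↦ Real.log 2 + 3 * poissonAbs u R z) 0 r :=
    (circleIntegrable_const _ _ _).add hΦ'
  rw [ValueDistribution.proximity_top]
  calc Real.circleAverage (fun z ↦ Real.posLog ‖deriv f z‖) 0 r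
      ≤ Real.circleAverage (fun z ↦ Real.log 2 + 3 * poissonAbs u R z +
        4 * (4 * R) ^ (1 / 2 : ℝ) * ∑ i ∈ S, |d i| * ‖z - i‖ ^ (-(1 / 2) : ℝ)) 0 r := by
        apply circleAverage_mono_codiscreteWithin hr0.ne'
        · exact hm.deriv.meromorphicOn.circleIntegrable_posLog_norm
        · exact hadd.add hsum'
        · filter_upwards [codiscreteWithin_mono (subset_univ _)
            S.finite_toSet.compl_mem_codiscrete, self_mem_codiscreteWithin _] with z h1 h2
          rw [abs_of_pos hr0, mem_sphere_zero_iff_norm] at h2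
          exact posLog_norm_deriv_le hu hci hS' hd1 hfS (by rw [h2]; exact hrR) h1
    _ = Real.log 2 + 3 * Real.circleAverage (poissonAbs u R) 0 r +
        4 * (4 * R) ^ (1 / 2 : ℝ) * ∑ i ∈ S,
          Real.circleAverage (fun z ↦ |d i| * ‖z - i‖ ^ (-(1 / 2) : ℝ)) 0 r := by
        rw [Real.circleAverage_fun_add hadd hsum',
          Real.circleAverage_fun_add (circleIntegrable_const _ _ _) hΦ', Real.circleAverage_const]
        have e1 := Real.circleAverage_fun_smul (a := (3 : ℝ)) (c := 0) (R := r)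
          (f := poissonAbs u R)
        have e2 := Real.circleAverage_fun_smul (a := 4 * (4 * R) ^ (1 / 2 : ℝ)) (c := 0) (R := r)
          (f := fun z ↦ ∑ i ∈ S, |d i| * ‖z - i‖ ^ (-(1 / 2) : ℝ))
        simp only [smul_eq_mul] at e1 e2
        rw [e1, e2, Real.circleAverage_fun_sum fun i _ ↦ (hterm i).1]
    _ ≤ Real.log 2 + 3 * (ValueDistribution.proximity f ⊤ R +
          ValueDistribution.proximity f⁻¹ ⊤ R) +
        4 * (4 * R) ^ (1 / 2 : ℝ) * ∑ i ∈ S, |d i| * (C * r ^ (-(1 / 2) : ℝ)) := by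
        rw [circleAverage_poissonAbs hci hr0.le (by linarith), havg]
        have h4R : (0 : ℝ) ≤ 4 * (4 * R) ^ (1 / 2 : ℝ) :=
          mul_nonneg (by norm_num) (Real.rpow_nonneg (by linarith) _)
        have := mul_le_mul_of_nonneg_left (Finset.sum_le_sum fun i (_ : i ∈ S) ↦ (hterm i).2) h4R
        linarith
    _ = _ := by
        rw [← Finset.sum_mul, Real.div_rpow (by linarith) hr0.le, Real.rpow_neg hr0.le,
          Real.mul_rpow (by norm_num) (by linarith)]
        ring

lemma exists_characteristic_deriv_le_of_NF {f : ℂ → ℂ} (hf : MeromorphicNFOn f univ)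
    (hf0 : ∀ z, meromorphicOrderAt f z ≠ ⊤) : ∃ C : ℝ, 0 < C ∧ ∀ r, 1 ≤ r →
      ValueDistribution.characteristic (deriv f) ⊤ r ≤
        C * (ValueDistribution.characteristic f ⊤ (4 * r) + 1) := by
  obtain ⟨C₁, hC₁, hbd⟩ := exists_proximity_deriv_le
  have hm : Meromorphic f := fun z ↦ hf.meromorphicOn z (mem_univ z)
  obtain ⟨C₂, hC₂, hT'⟩ := exists_characteristic_sub_const_le hm 0
  have hT : ∀ r, ValueDistribution.characteristic f⁻¹ ⊤ r ≤
      ValueDistribution.characteristic f ⊤ r + C₂ := fun r ↦ by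
    simpa using (hT' r).2
  set D : ℝ := max C₂ 1 with hD
  have hD1 : 1 ≤ D := le_max_right _ _
  have hDC : C₂ ≤ D := le_max_left _ _
  refine ⟨9 * D + C₁ * 3 * (8 * D), by positivity, fun r hr ↦ ?_⟩
  obtain ⟨R, ⟨hR1, hR2⟩, hsph⟩ := exists_radius_divisor_eq_zero (divisor f univ)
    (a := 2 * r) (b := 3 * r) (by linarith)
  have hfin : {z | divisor f univ z = 0} ∈ codiscrete ℂ := by
    filter_upwards [eventually_analyticAt_and_ne_zero hm hf0] with z hz
    exact divisor_eq_zero_of_ne_zero hm hz.1 hz.2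
  obtain ⟨S, hS⟩ := exists_finset_mem_iff hfin R
  have key := hbd hf hf0 hr (by linarith) hsph hS
  set T : ℝ := ValueDistribution.characteristic f ⊤ (4 * r) with hTdef
  have hT0 : 0 ≤ T := ValueDistribution.characteristic_nonneg (by linarith)
  have hmono : ∀ x, 0 < x → x ≤ 4 * r → ValueDistribution.characteristic f ⊤ x ≤ T := fun x h h' ↦
    ValueDistribution.characteristic_monotoneOn hm (mem_Ioi.2 h) (mem_Ioi.2 (by linarith)) h'
  have hTR := hmono R (by linarith) (by linarith)
  have hTr := hmono r (by linarith) (by linarith)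
  have hN : ValueDistribution.logCounting (deriv f) ⊤ r ≤ 2 * T :=
    (logCounting_deriv_le hf hr).trans (by linarith [logCounting_le_characteristic (g := f) (r := r)])
  have hprox : ValueDistribution.proximity f ⊤ R + ValueDistribution.proximity f⁻¹ ⊤ R ≤
      2 * T + D := by
    linarith [proximity_le_characteristic (g := f) (r := R) (by linarith),
      proximity_le_characteristic (g := f⁻¹) (r := R) (by linarith), hT R]
  have hcount : ∑ i ∈ S, |(divisor f univ i : ℝ)| ≤ 8 * D * (T + 1) := by
    have h1 := sum_abs_divisor_mul_log_le f (R := R) (R' := 4 * r) (by linarith) (by linarith)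
      (S := S) (fun z hz ↦ (mem_ball_zero_iff.1 ((hS z).1 hz).1).le)
    have h2 := logCounting_le_characteristic (g := f) (r := 4 * r)
    have h3 := logCounting_le_characteristic (g := f⁻¹) (r := 4 * r)
    have h4 := hT (4 * r)
    have h5 : 1 / 4 ≤ Real.log (4 * r / R) := by
      refine le_trans ?_ (div_le_log_div (by linarith) (by linarith))
      rw [div_le_div_iff₀ (by norm_num) (by linarith)]
      linarith
    have h6 : 0 ≤ ∑ i ∈ S, |(divisor f univ i : ℝ)| := Finset.sum_nonneg fun i _ ↦ abs_nonneg _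
    have h7 := mul_le_mul_of_nonneg_left h5 h6
    nlinarith
  have hsqrt : (R / r) ^ (1 / 2 : ℝ) ≤ 3 := by
    have h1 : 1 ≤ R / r := by rw [le_div_iff₀ (by linarith)]; linarith
    have h2 : R / r ≤ 3 := by rw [div_le_iff₀ (by linarith)]; linarith
    calc (R / r) ^ (1 / 2 : ℝ) ≤ (R / r) ^ (1 : ℝ) :=
          Real.rpow_le_rpow_of_exponent_le h1 (by norm_num)
      _ ≤ 3 := by rwa [Real.rpow_one]
  have hlog2 : Real.log 2 ≤ 1 := by linarith [Real.log_two_lt_d9]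
  have h8 : C₁ * (R / r) ^ (1 / 2 : ℝ) * ∑ i ∈ S, |(divisor f univ i : ℝ)| ≤
      C₁ * 3 * (8 * D * (T + 1)) := by
    gcongr
  rw [ValueDistribution.characteristic, Pi.add_apply]
  nlinarith

/-- Identity theorem: on the connected plane, infinite order at one point spreads to all points. -/
lemma meromorphicOrderAt_ne_top {f : ℂ → ℂ} (hf : Meromorphic f) (hf0 : ¬ f =ᶠ[codiscrete ℂ] 0)
    (z : ℂ) : meromorphicOrderAt f z ≠ ⊤ := by
  intro hz
  apply hf0
  have hall : ∀ x, meromorphicOrderAt f x = ⊤ := by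
    by_contra! h
    obtain ⟨x, hx⟩ := h
    exact hf.meromorphicOn.meromorphicOrderAt_ne_top_of_isPreconnected (U := univ)
      isPreconnected_univ (mem_univ x) (mem_univ z) hx hz
  change {x | f x = 0} ∈ codiscreteWithin univ
  rw [mem_codiscreteWithin_iff_forall_mem_nhdsNE]
  intro x _
  filter_upwards [meromorphicOrderAt_eq_top_iff.1 (hall x)] with y hy
  simpa using hy

lemma exists_normalForm {f : ℂ → ℂ} (hf : Meromorphic f) : ∃ F : ℂ → ℂ, MeromorphicNFOn F univ ∧
    f =ᶠ[codiscrete ℂ] F ∧ deriv f =ᶠ[codiscrete ℂ] deriv F := by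
  have h1 := meromorphicNFOn_toMeromorphicNFOn f univ
  have h2 := toMeromorphicNFOn_eqOn_codiscrete (hf.meromorphicOn (s := univ))
  exact ⟨_, h1, h2, hf.meromorphicOn.deriv_eventuallyEq_codiscreteWithin h1.meromorphicOn h2⟩

/-- The characteristic ignores changes on a discrete set, so f may be put in normal form. The
dilation 4r is harmless, as it only affects constants in a bound exp(r^s). -/
lemma exists_characteristic_deriv_le {f : ℂ → ℂ} (hf : Meromorphic f)
    (hf0 : ¬ f =ᶠ[codiscrete ℂ] 0) : ∃ C : ℝ, 0 < C ∧ ∀ r, 1 ≤ r →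
      ValueDistribution.characteristic (deriv f) ⊤ r ≤
        C * (ValueDistribution.characteristic f ⊤ (4 * r) + 1) := by
  obtain ⟨F, hF, hfF, hfF'⟩ := exists_normalForm hf
  obtain ⟨C, hC, h⟩ := exists_characteristic_deriv_le_of_NF hF
    (meromorphicOrderAt_ne_top (fun z ↦ hF.meromorphicOn z (mem_univ z))
      fun h0 ↦ hf0 (hfF.trans h0))
  refine ⟨C, hC, fun r hr ↦ ?_⟩
  rw [ValueDistribution.characteristic_congr_codiscrete hfF (by linarith),
    ValueDistribution.characteristic_congr_codiscrete hfF' (by linarith)]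
  exact h r hr

/-! ### Slow growth of the characteristic of the derivative forces rationality -/

/-- Cauchy's estimates kill every Taylor coefficient of index above n. Each one needs only a single
sufficiently large radius, so a bound along an unbounded set of radii is enough. -/
lemma exists_polynomial_of_frequently_le {H : ℂ → ℂ} (hH : Differentiable ℂ H) {K : ℝ} {n : ℕ}
    (h : ∃ᶠ ρ : ℝ in atTop, ∀ z ∈ sphere (0 : ℂ) ρ, ‖H z‖ ≤ K * ρ ^ n) :
    ∃ p : Polynomial ℂ, ∀ z, H z = p.eval z := by
  have hz : ∀ m, n < m → iteratedDeriv m H 0 = 0 := by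
    intro m hm
    by_contra h0
    have h0' : 0 < ‖iteratedDeriv m H 0‖ := norm_pos_iff.2 h0
    obtain ⟨ρ, hρ, hle⟩ := frequently_atTop.1 h
      (max 1 (m.factorial * K / ‖iteratedDeriv m H 0‖ + 1))
    have hρ1 : 1 ≤ ρ := (le_max_left _ _).trans hρ
    have hρ2 : m.factorial * K / ‖iteratedDeriv m H 0‖ + 1 ≤ ρ := (le_max_right _ _).trans hρ
    have hρ0 : 0 < ρ := by linarith
    have hC := Complex.norm_iteratedDeriv_le_of_forall_mem_sphere_norm_le m hρ0
      hH.diffContOnCl hle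
    have hK : 0 ≤ K := by
      have h1 := (norm_nonneg _).trans (hle (ρ : ℂ) (by simp [hρ0.le]))
      exact nonneg_of_mul_nonneg_left h1 (by positivity)
    have h2 : m.factorial * (K * ρ ^ n) / ρ ^ m ≤ m.factorial * K / ρ := by
      rw [div_le_div_iff₀ (by positivity) hρ0]
      have : ρ ^ n * ρ ≤ ρ ^ m := by
        rw [← pow_succ]
        exact pow_le_pow_right₀ hρ1 hm
      calc m.factorial * (K * ρ ^ n) * ρ = m.factorial * K * (ρ ^ n * ρ) := by ring
        _ ≤ _ := by gcongr
    have h3 : ‖iteratedDeriv m H 0‖ * ρ ≤ m.factorial * K := by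
      rw [← le_div_iff₀ hρ0]
      exact hC.trans h2
    have h4 : m.factorial * K < ρ * ‖iteratedDeriv m H 0‖ := by
      rw [← div_lt_iff₀ h0']; linarith
    linarith
  refine ⟨∑ m ∈ Finset.range (n + 1),
    Polynomial.C ((m.factorial : ℂ)⁻¹ * iteratedDeriv m H 0) * Polynomial.X ^ m, fun z ↦ ?_⟩
  rw [← Complex.taylorSeries_eq_of_entire' 0 z hH, tsum_eq_sum (s := Finset.range (n + 1)),
    Polynomial.eval_finsetSum]
  · simp
  · intro m hm
    rw [hz m (by simpa using hm)]
    simp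

lemma exists_norm_eval_le (q : Polynomial ℂ) : ∃ K : ℝ, 0 ≤ K ∧ ∀ z : ℂ, 1 ≤ ‖z‖ →
    ‖q.eval z‖ ≤ K * ‖z‖ ^ q.natDegree := by
  refine ⟨∑ i ∈ Finset.range (q.natDegree + 1), ‖q.coeff i‖,
    Finset.sum_nonneg fun _ _ ↦ norm_nonneg _, fun z hz ↦ ?_⟩
  rw [Polynomial.eval_eq_sum_range, Finset.sum_mul]
  refine (norm_sum_le _ _).trans (Finset.sum_le_sum fun i hi ↦ ?_)
  rw [norm_mul, norm_pow]
  gcongr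
  exact Nat.lt_succ_iff.1 (Finset.mem_range.1 hi)

lemma exists_rational_of_frequently_le {f : ℂ → ℂ} (hf : Meromorphic f) {Q : Finset ℂ}
    (hQ : ∀ z ∉ Q, AnalyticAt ℂ f z) {K : ℝ} {n : ℕ}
    (h : ∃ᶠ ρ : ℝ in atTop, ∀ z ∈ sphere (0 : ℂ) ρ, ‖f z‖ ≤ K * ρ ^ n) :
    ∃ p q : Polynomial ℂ, q ≠ 0 ∧ f =ᶠ[codiscrete ℂ] fun z ↦ p.eval z / q.eval z := by
  -- The exponents k z are those for which (w - z)^(k z) f(w) is analytic at z, so the product q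
  -- below clears all the exceptional points.
  choose k hk using fun z ↦ hf z
  set q : Polynomial ℂ := ∏ i ∈ Q, (Polynomial.X - Polynomial.C i) ^ k i with hq
  have hqe : ∀ z, q.eval z = ∏ i ∈ Q, (z - i) ^ k i := fun z ↦ by
    rw [hq, Polynomial.eval_prod]; simp
  have hq0 : ∀ z ∉ Q, q.eval z ≠ 0 := fun z hz ↦ by
    rw [hqe]
    exact Finset.prod_ne_zero_iff.2 fun i hi ↦
      pow_ne_zero _ (sub_ne_zero.2 fun h ↦ hz (h ▸ hi))
  have hqan : ∀ z, AnalyticAt ℂ (fun z ↦ q.eval z) z := fun z ↦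
    (Polynomial.differentiable q).analyticAt z
  have hdiff : Differentiable ℂ fun z ↦ q.eval z * f z := by
    intro z
    by_cases hz : z ∈ Q
    · have e : (fun z ↦ q.eval z * f z) =
          fun w ↦ (∏ i ∈ Q.erase z, (w - i) ^ k i) * ((w - z) ^ k z • f w) := by
        funext w
        rw [hqe, ← Finset.mul_prod_erase Q _ hz, smul_eq_mul]
        ring
      rw [e]
      refine DifferentiableAt.mul ?_ (hk z).differentiableAt
      exact DifferentiableAt.fun_finsetProd fun i _ ↦ by fun_prop
    · exact (hqan z).differentiableAt.mul (hQ z hz).differentiableAt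
  obtain ⟨K', hK', hqle⟩ := exists_norm_eval_le q
  obtain ⟨p, hp⟩ := exists_polynomial_of_frequently_le hdiff (K := K' * K) (n := q.natDegree + n)
    ((h.and_eventually (eventually_ge_atTop 1)).mono fun ρ hρ z hz ↦ by
      have h1 := hρ.1 z hz
      rw [mem_sphere_zero_iff_norm] at hz
      have h2 := hqle z (by rw [hz]; exact hρ.2)
      rw [hz] at h2
      rw [norm_mul, pow_add]
      calc ‖q.eval z‖ * ‖f z‖ ≤ K' * ρ ^ q.natDegree * (K * ρ ^ n) :=
            mul_le_mul h2 h1 (norm_nonneg _) ((norm_nonneg _).trans h2)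
        _ = _ := by ring)
  refine ⟨p, q, fun h0 ↦ ?_, ?_⟩
  · obtain ⟨z, hz⟩ := (Set.toFinite (Q : Set ℂ)).infinite_compl.nonempty
    exact hq0 z hz (by rw [h0, Polynomial.eval_zero])
  · filter_upwards [Q.finite_toSet.compl_mem_codiscrete] with z hz
    rw [← hp z, mul_div_cancel_left₀ _ (hq0 z hz)]

/-- Poles of modulus at most √r each contribute at least log(r/√r) = (log r)/2 to N(r,f'), so more
than 2C of them contradict the bound for large r. -/
lemma finite_poles_of_frequently_le {f : ℂ → ℂ} (hf : MeromorphicNFOn f univ) {C : ℝ}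
    (h : ∃ᶠ r : ℝ in atTop, ValueDistribution.characteristic (deriv f) ⊤ r ≤ C * Real.log r) :
    ∃ Q : Finset ℂ, ∀ z ∉ Q, AnalyticAt ℂ f z := by
  have hm : Meromorphic f := fun z ↦ hf.meromorphicOn z (mem_univ z)
  set A : Set ℂ := {z | ¬ AnalyticAt ℂ f z} with hA
  have hD : ∀ z ∈ A, 1 ≤ (divisor (deriv f) univ)⁻ z := by
    intro z hz
    obtain ⟨n, hn, hn'⟩ := (MeromorphicNFOn.analyticAt_or_order_neg hf z).resolve_left hz
    have h' := meromorphicOrderAt_deriv_eq_sub_one (Int.cast_ne_zero.2 hn.ne) hn'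
    rw [Function.locallyFinsuppWithin.negPart_apply, divisor_apply hm.deriv.meromorphicOn
      (mem_univ z), h', WithTop.untop₀_coe, negPart_def, sup_eq_left.2 (by omega)]
    omega
  have hfin : A.Finite := by
    by_contra hinf
    obtain ⟨S, hSA, hScard⟩ := Set.Infinite.exists_subset_card_eq hinf (⌈2 * C⌉₊ + 1)
    obtain ⟨B, hB⟩ : ∃ B : ℝ, ∀ z ∈ S, ‖z‖ ≤ B :=
      (S.finite_toSet.isCompact.isBounded.exists_norm_le)
    obtain ⟨r, hr, hT⟩ := frequently_atTop.1 h (max 2 (max 1 B ^ 2))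
    have hr2 : 2 ≤ r := (le_max_left _ _).trans hr
    have hrB : max 1 B ≤ √r := Real.le_sqrt_of_sq_le ((le_max_right _ _).trans hr)
    have hr1 : 1 ≤ √r := (le_max_left _ _).trans hrB
    have hlog : 0 < Real.log r := Real.log_pos (by linarith)
    have h1 := sum_mul_log_le_logCounting (negPart_nonneg (divisor (deriv f) univ))
      hr1 (R' := r) (Real.sqrt_le_iff.2 ⟨by linarith, by nlinarith⟩) (S := S)
      (fun z hz ↦ (hB z hz).trans ((le_max_right _ _).trans hrB))
    rw [Real.div_sqrt, Real.log_sqrt (by linarith), ← ValueDistribution.logCounting_top] at h1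
    have h2 := logCounting_le_characteristic (g := deriv f) (r := r)
    have h3 : (S.card : ℝ) ≤ ∑ i ∈ S, (((divisor (deriv f) univ)⁻ i : ℤ) : ℝ) := by
      rw [Finset.card_eq_sum_ones, Nat.cast_sum]
      exact Finset.sum_le_sum fun i hi ↦ by exact_mod_cast hD i (hSA hi)
    have h4 : (S.card : ℝ) * (Real.log r / 2) ≤ C * Real.log r :=
      (mul_le_mul_of_nonneg_right h3 (by positivity)).trans (by linarith)
    have h5 : (S.card : ℝ) ≤ 2 * C := by
      rw [← mul_le_mul_iff_left₀ hlog]; linarith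
    rw [hScard] at h5
    push_cast at h5
    linarith [Nat.le_ceil (2 * C)]
  exact ⟨hfin.toFinset, fun z hz ↦ by simpa [hA] using hz⟩

/-- With ν the total multiplicity of poles in Q, poles cost at most ν log(2R) at distance 1 or more
from Q; the 3 is Harnack's constant for |z| ≤ R/2. -/
lemma exists_norm_le_exp_of_analyticAt_compl {g : ℂ → ℂ} (hg : Meromorphic g)
    (hg0 : ∀ z, meromorphicOrderAt g z ≠ ⊤) {Q : Finset ℂ} (hQ : ∀ z ∉ Q, AnalyticAt ℂ g z) :
    ∃ ν : ℝ, 0 ≤ ν ∧ ∀ {R : ℝ}, 1 ≤ R → (∀ z ∈ sphere (0 : ℂ) R, divisor g univ z = 0) →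
      ∀ z : ℂ, ‖z‖ ≤ R / 2 → (∀ i ∈ Q, 1 ≤ ‖z - i‖) → ‖g z‖ ≤
        Real.exp (3 * (ValueDistribution.proximity g ⊤ R + ValueDistribution.proximity g⁻¹ ⊤ R) +
          ν * Real.log (2 * R)) := by
  classical
  refine ⟨∑ i ∈ Q, max (-(divisor g univ i : ℝ)) 0,
    Finset.sum_nonneg fun _ _ ↦ le_max_right _ _, fun {R} hR hsph z hz hzQ ↦ ?_⟩
  by_cases h0 : g z = 0
  · rw [h0, norm_zero]; positivity
  have hzan : AnalyticAt ℂ g z := hQ z fun h ↦ by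
    have := hzQ z h
    rw [sub_self, norm_zero] at this
    linarith
  have hfin : {z | divisor g univ z = 0} ∈ codiscrete ℂ := by
    filter_upwards [eventually_analyticAt_and_ne_zero hg hg0] with z hz
    exact divisor_eq_zero_of_ne_zero hg hz.1 hz.2
  obtain ⟨S, hS⟩ := exists_finset_mem_iff hfin R
  have hS' : ∀ i ∈ S, i ∈ ball (0 : ℂ) R := fun i hi ↦ ((hS i).1 hi).1
  obtain ⟨u, hu, hci, havg, hPJ⟩ := exists_poissonJensen hg hg0 (by linarith) hsph (S := S)
    (fun z hz hd ↦ (hS z).2 ⟨hz, hd⟩) hS'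
  have hzb : z ∈ ball (0 : ℂ) R := by rw [mem_ball_zero_iff]; linarith
  have hzS : z ∉ S := fun h ↦ ((hS z).1 h).2 (divisor_eq_zero_of_ne_zero hg hzan h0)
  refine (norm_le_exp_of_poissonJensen hS' hzb hzS h0 (hPJ z hzb hzan h0)).trans ?_
  apply Real.exp_le_exp.2
  have h1 := (le_poissonAbs hu hci hzb).trans (poissonAbs_le hci hzb)
  rw [havg] at h1
  have h2 : (R + ‖z‖) / (R - ‖z‖) ≤ 3 := by
    rw [div_le_iff₀ (by linarith)]; linarith
  have h3 : 0 ≤ ValueDistribution.proximity g ⊤ R + ValueDistribution.proximity g⁻¹ ⊤ R :=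
    add_nonneg (ValueDistribution.proximity_nonneg R) (ValueDistribution.proximity_nonneg R)
  have h4 := mul_le_mul_of_nonneg_right h2 h3
  have hlog : 0 ≤ Real.log (2 * R) := Real.log_nonneg (by linarith)
  have hdQ : ∀ i ∉ Q, max (-(divisor g univ i : ℝ)) 0 = 0 := fun i hi ↦ by
    apply max_eq_right
    have : (0 : ℝ) ≤ divisor g univ i := by exact_mod_cast divisor_nonneg_of_analyticAt (hQ i hi)
    linarith
  have h5 : ∑ i ∈ S, max (-(divisor g univ i : ℝ)) 0 * Real.log (2 * R / ‖z - i‖) ≤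
      (∑ i ∈ Q, max (-(divisor g univ i : ℝ)) 0) * Real.log (2 * R) := by
    calc _ ≤ ∑ i ∈ S, max (-(divisor g univ i : ℝ)) 0 * Real.log (2 * R) := by
          apply Finset.sum_le_sum
          intro i hi
          by_cases hiQ : i ∈ Q
          · have h6 := hzQ i hiQ
            apply mul_le_mul_of_nonneg_left _ (le_max_right _ _)
            apply Real.log_le_log (by positivity)
            exact div_le_self (by linarith) h6
          · rw [hdQ i hiQ, zero_mul, zero_mul]
      _ = (∑ i ∈ S with i ∈ Q, max (-(divisor g univ i : ℝ)) 0) * Real.log (2 * R) := by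
          rw [← Finset.sum_mul, Finset.sum_filter_of_ne fun i _ h ↦ by
            by_contra hn
            exact h (hdQ i hn)]
      _ ≤ _ := by
          gcongr
          exact fun i hi ↦ (Finset.mem_filter.1 hi).2
  linarith

/-- Integrate the derivative along the ray from the fixed circle of radius ρ₀, on which f is bounded
by compactness. -/
lemma exists_norm_le_of_norm_deriv_le {f : ℂ → ℂ} {ρ₀ : ℝ} (hρ₀ : 0 < ρ₀)
    (hf : ∀ z, ρ₀ ≤ ‖z‖ → AnalyticAt ℂ f z) : ∃ M₀ : ℝ, 0 ≤ M₀ ∧ ∀ {ρ M : ℝ}, ρ₀ ≤ ρ →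
      (∀ z, ρ₀ ≤ ‖z‖ → ‖z‖ ≤ ρ → ‖deriv f z‖ ≤ M) →
      ∀ z ∈ sphere (0 : ℂ) ρ, ‖f z‖ ≤ M₀ + M * ρ := by
  have hcont : ContinuousOn f (sphere 0 ρ₀) := fun z hz ↦
    (hf z (mem_sphere_zero_iff_norm.1 hz).ge).continuousAt.continuousWithinAt
  obtain ⟨M₀, hM₀⟩ := (isCompact_sphere (0 : ℂ) ρ₀).exists_bound_of_continuousOn hcont
  refine ⟨M₀, (norm_nonneg _).trans (hM₀ (ρ₀ : ℂ) (by simp [hρ₀.le])),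
    fun {ρ M} hρ hM z hz ↦ ?_⟩
  rw [mem_sphere_zero_iff_norm] at hz
  have hρ0 : 0 < ρ := hρ₀.trans_le hρ
  set ζ : ℂ := (ρ : ℂ)⁻¹ * z with hζ
  have hζ1 : ‖ζ‖ = 1 := by
    rw [hζ, norm_mul, norm_inv, Complex.norm_real, Real.norm_of_nonneg hρ0.le, hz,
      inv_mul_cancel₀ hρ0.ne']
  have hnorm : ∀ t : ℝ, ρ₀ ≤ t → ‖(t : ℂ) * ζ‖ = t := fun t ht ↦ by
    rw [norm_mul, hζ1, mul_one, Complex.norm_real, Real.norm_of_nonneg (hρ₀.le.trans ht)]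
  have hder : ∀ t ∈ Icc ρ₀ ρ, HasDerivWithinAt (fun t : ℝ ↦ f ((t : ℂ) * ζ))
      (deriv f ((t : ℂ) * ζ) * ζ) (Icc ρ₀ ρ) t := by
    intro t ht
    have h1 : HasDerivAt (fun t : ℝ ↦ (t : ℂ) * ζ) ζ t := by
      simpa using (Complex.ofRealCLM.hasDerivAt (x := t)).mul_const ζ
    have h2 := (hf _ (ht.1.trans (hnorm t ht.1).ge)).differentiableAt.hasDerivAt
    exact (h2.comp t h1).hasDerivWithinAt
  have hb : ∀ t ∈ Icc ρ₀ ρ, ‖deriv f ((t : ℂ) * ζ) * ζ‖ ≤ M := by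
    intro t ht
    rw [norm_mul, hζ1, mul_one]
    exact hM _ (ht.1.trans (hnorm t ht.1).ge) ((hnorm t ht.1).le.trans ht.2)
  have h3 := (convex_Icc ρ₀ ρ).norm_image_sub_le_of_norm_hasDerivWithin_le hder hb
    (left_mem_Icc.2 hρ) (right_mem_Icc.2 hρ)
  have hM0 : 0 ≤ M := (norm_nonneg _).trans (hb ρ (right_mem_Icc.2 hρ))
  have e : (ρ : ℂ) * ζ = z := by
    rw [hζ, mul_inv_cancel_left₀ (Complex.ofReal_ne_zero.2 hρ0.ne')]
  rw [e, Real.norm_of_nonneg (by linarith)] at h3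
  have h4 := hM₀ ((ρ₀ : ℂ) * ζ) (by rw [mem_sphere_zero_iff_norm, hnorm ρ₀ le_rfl])
  have h5 := norm_add_le (f z - f ((ρ₀ : ℂ) * ζ)) (f ((ρ₀ : ℂ) * ζ))
  rw [sub_add_cancel] at h5
  nlinarith

lemma exists_rational_of_NF_of_frequently_le {f : ℂ → ℂ} (hf : MeromorphicNFOn f univ) {a : ℂ}
    (hg0 : ∀ z, meromorphicOrderAt (fun z ↦ deriv f z - a) z ≠ ⊤) {C : ℝ}
    (h : ∃ᶠ r : ℝ in atTop, ValueDistribution.characteristic (deriv f) ⊤ r ≤ C * Real.log r) :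
    ∃ p q : Polynomial ℂ, q ≠ 0 ∧ f =ᶠ[codiscrete ℂ] fun z ↦ p.eval z / q.eval z := by
  have hm : Meromorphic f := fun z ↦ hf.meromorphicOn z (mem_univ z)
  obtain ⟨Q, hQ⟩ := finite_poles_of_frequently_le hf h
  set g : ℂ → ℂ := fun z ↦ deriv f z - a with hg
  have hgm : Meromorphic g := hm.deriv.sub (Meromorphic.const a)
  have hgQ : ∀ z ∉ Q, AnalyticAt ℂ g z := fun z hz ↦ (hQ z hz).deriv.sub analyticAt_const
  obtain ⟨C₂, hC₂, hT⟩ := exists_characteristic_sub_const_le hm.deriv a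
  obtain ⟨ν, hν, hgle⟩ := exists_norm_le_exp_of_analyticAt_compl hgm hg0 hgQ
  obtain ⟨B, hB⟩ : ∃ B : ℝ, ∀ z ∈ Q, ‖z‖ ≤ B := Q.finite_toSet.isCompact.isBounded.exists_norm_le
  set ρ₀ : ℝ := max B 0 + 1 with hρ₀
  have hρ₀1 : 1 ≤ ρ₀ := by have := le_max_right B 0; linarith
  have hfar : ∀ z, ρ₀ ≤ ‖z‖ → ∀ i ∈ Q, 1 ≤ ‖z - i‖ := fun z hz i hi ↦ by
    have h1 := hB i hi
    have h2 := le_max_left B 0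
    have h3 := norm_sub_norm_le z i
    linarith
  have hfan : ∀ z, ρ₀ ≤ ‖z‖ → AnalyticAt ℂ f z := fun z hz ↦ hQ z fun hzQ ↦ by
    have := hfar z hz z hzQ
    rw [sub_self, norm_zero] at this
    linarith
  obtain ⟨M₀, hM₀, hfle⟩ := exists_norm_le_of_norm_deriv_le (by linarith) hfan
  -- 6 = 3 · 2: Harnack's factor times the two proximity functions. Each of the logarithms of r and
  -- 2R is at most 2 log ρ because ρ ≥ 8, whence the degree ⌈2c⌉.
  set c : ℝ := 6 * max C 0 + ν with hc
  have hc0 : 0 ≤ c := by have := le_max_right C 0; linarith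
  set n : ℕ := ⌈2 * c⌉₊ with hn
  apply exists_rational_of_frequently_le hm hQ (K := M₀ + Real.exp (6 * C₂) + ‖a‖) (n := n + 1)
  rw [frequently_atTop]
  intro A
  obtain ⟨r, hr, hTr⟩ := frequently_atTop.1 h (max (4 * max A (max 8 ρ₀)) 1)
  have hr4 : 4 * max A (max 8 ρ₀) ≤ r := (le_max_left _ _).trans hr
  have hrA : 4 * A ≤ r := by linarith [le_max_left A (max 8 ρ₀)]
  have hr8 : 32 ≤ r := by linarith [le_max_right A (max 8 ρ₀), le_max_left 8 ρ₀]
  have hrρ : 4 * ρ₀ ≤ r := by linarith [le_max_right A (max 8 ρ₀), le_max_right 8 ρ₀]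
  obtain ⟨R, ⟨hR1, hR2⟩, hsph⟩ := exists_radius_divisor_eq_zero (divisor g univ)
    (a := r / 2) (b := r) (by linarith)
  refine ⟨R / 2, by linarith, ?_⟩
  set ρ : ℝ := R / 2 with hρ
  have hρ8 : 8 ≤ ρ := by linarith
  have hlogρ : 0 ≤ Real.log ρ := Real.log_nonneg (by linarith)
  have hlog8 : Real.log (8 * ρ) ≤ 2 * Real.log ρ := by
    rw [Real.log_mul (by norm_num) (by linarith)]
    linarith [Real.log_le_log (by norm_num) hρ8]
  have hlogr : Real.log r ≤ 2 * Real.log ρ :=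
    (Real.log_le_log (by linarith) (by linarith)).trans hlog8
  have hlogR : Real.log (2 * R) ≤ 2 * Real.log ρ :=
    (Real.log_le_log (by linarith) (by linarith)).trans hlog8
  have hTR : ValueDistribution.characteristic (deriv f) ⊤ R ≤ max C 0 * (2 * Real.log ρ) := by
    calc _ ≤ ValueDistribution.characteristic (deriv f) ⊤ r :=
          ValueDistribution.characteristic_monotoneOn hm.deriv (mem_Ioi.2 (by linarith))
            (mem_Ioi.2 (by linarith)) hR2.le
      _ ≤ C * Real.log r := hTr
      _ ≤ max C 0 * Real.log r :=
          mul_le_mul_of_nonneg_right (le_max_left _ _) (Real.log_nonneg (by linarith))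
      _ ≤ _ := mul_le_mul_of_nonneg_left hlogr (le_max_right _ _)
  have hprox : ValueDistribution.proximity g ⊤ R + ValueDistribution.proximity g⁻¹ ⊤ R ≤
      2 * (max C 0 * (2 * Real.log ρ)) + 2 * C₂ := by
    linarith [proximity_le_characteristic (g := g) (r := R) (by linarith),
      proximity_le_characteristic (g := g⁻¹) (r := R) (by linarith), (hT R).1, (hT R).2]
  have hder : ∀ z, ρ₀ ≤ ‖z‖ → ‖z‖ ≤ ρ →
      ‖deriv f z‖ ≤ Real.exp (6 * C₂) * ρ ^ n + ‖a‖ := by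
    intro z hz hzρ
    have h1 := hgle (R := R) (by linarith) hsph z hzρ (hfar z hz)
    have h2 : 3 * (ValueDistribution.proximity g ⊤ R + ValueDistribution.proximity g⁻¹ ⊤ R) +
        ν * Real.log (2 * R) ≤ 6 * C₂ + n * Real.log ρ := by
      have h3 := mul_le_mul_of_nonneg_left hlogR hν
      have h4 := mul_le_mul_of_nonneg_right (Nat.le_ceil (2 * c)) hlogρ
      rw [← hn] at h4
      nlinarith
    have h3 := h1.trans (Real.exp_le_exp.2 h2)
    rw [Real.exp_add, Real.exp_nat_mul, Real.exp_log (by linarith)] at h3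
    calc ‖deriv f z‖ = ‖g z + a‖ := by simp [hg]
      _ ≤ ‖g z‖ + ‖a‖ := norm_add_le _ _
      _ ≤ _ := by linarith
  intro z hz
  refine (hfle (by linarith) hder z hz).trans ?_
  have h6 : 1 ≤ ρ ^ n := one_le_pow₀ (by linarith)
  have h7 : 1 ≤ ρ ^ n * ρ := by nlinarith
  have h8 : ‖a‖ * ρ ≤ ‖a‖ * (ρ ^ n * ρ) :=
    mul_le_mul_of_nonneg_left (by nlinarith) (norm_nonneg a)
  rw [pow_succ]
  nlinarith

lemma eventually_lt_characteristic_deriv {f : ℂ → ℂ} (hf : Meromorphic f)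
    (htr : VarShift.IsTranscendental f) {a : ℂ} (ha : ¬ deriv f =ᶠ[codiscrete ℂ] fun _ ↦ a)
    (C : ℝ) : ∀ᶠ r : ℝ in atTop,
      C * Real.log r < ValueDistribution.characteristic (deriv f) ⊤ r := by
  by_contra hcon
  obtain ⟨F, hF, hfF, hfF'⟩ := exists_normalForm hf
  have hm : Meromorphic F := fun z ↦ hF.meromorphicOn z (mem_univ z)
  have hg0 : ∀ z, meromorphicOrderAt (fun z ↦ deriv F z - a) z ≠ ⊤ :=
    meromorphicOrderAt_ne_top (hm.deriv.sub (Meromorphic.const a)) fun h0 ↦ ha (by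
      filter_upwards [hfF', h0] with z h1 h2
      rw [h1]
      exact sub_eq_zero.1 h2)
  obtain ⟨p, q, hq, hpq⟩ := exists_rational_of_NF_of_frequently_le hF hg0 (C := C)
    ((not_eventually.1 hcon).and_eventually (eventually_gt_atTop 0) |>.mono fun r hr ↦ by
      rw [← ValueDistribution.characteristic_congr_codiscrete hfF' hr.2.ne']
      exact not_lt.1 hr.1)
  exact htr ⟨p, q, hq, hfF.trans hpq⟩

/-! ### Growth of the characteristic in terms of the hyper-order -/

lemma le_exp_of_posLog_le {x L : ℝ} (h : Real.posLog x ≤ L) : x ≤ Real.exp L := by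
  rcases le_or_gt x 0 with hx | hx
  · exact hx.trans (Real.exp_pos _).le
  · rw [← Real.log_le_iff_le_exp hx]
    exact (le_max_right _ _).trans h

lemma eventually_posLog_characteristic_le {f : ℂ → ℂ} {ς s : ℝ}
    (hς : VarShift.hyperOrder f = (ς : EReal)) (hs : ς < s) :
    ∀ᶠ r : ℝ in atTop, Real.posLog (ValueDistribution.characteristic f ⊤ r) ≤ r ^ s := by
  have h : limsup (fun r : ℝ ↦ ((Real.posLog (Real.posLog (VarShift.T r f)) / Real.log r : ℝ) :
      EReal)) atTop < (s : EReal) := by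
    rw [VarShift.hyperOrder] at hς
    rw [hς]
    exact_mod_cast hs
  filter_upwards [eventually_lt_of_limsup_lt h, eventually_gt_atTop 1] with r h1 hr
  have h2 := EReal.coe_lt_coe_iff.1 h1
  rw [div_lt_iff₀ (Real.log_pos hr)] at h2
  have h3 := le_exp_of_posLog_le h2.le
  rwa [mul_comm, Real.exp_mul, Real.exp_log (by linarith)] at h3

lemma hyperOrder_nonneg {f : ℂ → ℂ} {ς : ℝ} (hς : VarShift.hyperOrder f = (ς : EReal)) :
    0 ≤ ς := by
  by_contra! hneg
  have h : limsup (fun r : ℝ ↦ ((Real.posLog (Real.posLog (VarShift.T r f)) / Real.log r : ℝ) :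
      EReal)) atTop < (0 : ℝ) := by
    rw [VarShift.hyperOrder] at hς
    rw [hς]
    exact_mod_cast hneg
  obtain ⟨r, h1, hr⟩ := ((eventually_lt_of_limsup_lt h).and (eventually_gt_atTop 1)).exists
  have h2 := EReal.coe_lt_coe_iff.1 h1
  have h3 : 0 ≤ Real.posLog (Real.posLog (VarShift.T r f)) / Real.log r :=
    div_nonneg Real.posLog_nonneg (Real.log_pos hr).le
  linarith

/-- The increasing function of which the exceptional set records the jumps. -/
def logCharacteristic (g : ℂ → ℂ) (r : ℝ) : ℝ :=
  Real.log (ValueDistribution.characteristic g ⊤ (max r 1) + 1)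

lemma logCharacteristic_nonneg (g : ℂ → ℂ) (r : ℝ) : 0 ≤ logCharacteristic g r := by
  have := ValueDistribution.characteristic_nonneg (f := g) (a := ⊤) (le_max_right r 1)
  exact Real.log_nonneg (by linarith)

lemma monotone_logCharacteristic {g : ℂ → ℂ} (hg : Meromorphic g) :
    Monotone (logCharacteristic g) := by
  intro x y hxy
  have h0 := ValueDistribution.characteristic_nonneg (f := g) (a := ⊤) (le_max_right x 1)
  have hpos : ∀ r : ℝ, max r 1 ∈ Ioi (0 : ℝ) := fun r ↦
    mem_Ioi.2 (lt_of_lt_of_le one_pos (le_max_right _ _))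
  have h1 := ValueDistribution.characteristic_monotoneOn hg (hpos x) (hpos y)
    (max_le_max_right 1 hxy)
  exact Real.log_le_log (by linarith) (by linarith)

lemma exists_logCharacteristic_deriv_le {f : ℂ → ℂ} (hf : Meromorphic f)
    (hf0 : ¬ f =ᶠ[codiscrete ℂ] 0) {ς s : ℝ} (hς : VarShift.hyperOrder f = (ς : EReal))
    (hs : ς < s) : ∃ C : ℝ, ∀ r, 1 ≤ r → logCharacteristic (deriv f) r ≤ C * r ^ s := by
  have hs0 : 0 ≤ s := (hyperOrder_nonneg hς).trans hs.le
  obtain ⟨C, hC, hT⟩ := exists_characteristic_deriv_le hf hf0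
  obtain ⟨r₀, hr₀⟩ := eventually_atTop.1 (eventually_posLog_characteristic_le hς hs)
  have hbig : ∀ r, max r₀ 1 ≤ r →
      logCharacteristic (deriv f) r ≤ (Real.log (2 * C + 1) + 4 ^ s) * r ^ s := by
    intro r hr
    have hr1 : 1 ≤ r := (le_max_right _ _).trans hr
    have h1 := le_exp_of_posLog_le (hr₀ (4 * r) (by linarith [le_max_left r₀ 1]))
    have h2 := hT r hr1
    have h3 : 1 ≤ Real.exp ((4 * r) ^ s) := Real.one_le_exp (by positivity)
    have h4 := ValueDistribution.characteristic_nonneg (f := deriv f) (a := ⊤) hr1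
    have h5 : ValueDistribution.characteristic (deriv f) ⊤ r + 1 ≤
        (2 * C + 1) * Real.exp ((4 * r) ^ s) := by nlinarith
    have h6 : 1 ≤ r ^ s := Real.one_le_rpow hr1 hs0
    rw [logCharacteristic, max_eq_left hr1]
    calc _ ≤ Real.log ((2 * C + 1) * Real.exp ((4 * r) ^ s)) :=
          Real.log_le_log (by linarith) h5
      _ = Real.log (2 * C + 1) + 4 ^ s * r ^ s := by
          rw [Real.log_mul (by positivity) (Real.exp_pos _).ne', Real.log_exp,
            Real.mul_rpow (by norm_num) (by linarith)]
      _ ≤ _ := by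
          have : 0 ≤ Real.log (2 * C + 1) := Real.log_nonneg (by linarith)
          nlinarith
  refine ⟨max (Real.log (2 * C + 1) + 4 ^ s) (logCharacteristic (deriv f) (max r₀ 1)),
    fun r hr ↦ ?_⟩
  rcases le_total (max r₀ 1) r with h | h
  · exact (hbig r h).trans (by gcongr; exact le_max_left _ _)
  · have h6 : 1 ≤ r ^ s := Real.one_le_rpow hr hs0
    calc _ ≤ logCharacteristic (deriv f) (max r₀ 1) := monotone_logCharacteristic hf.deriv h
      _ ≤ logCharacteristic (deriv f) (max r₀ 1) * r ^ s :=
          le_mul_of_one_le_right (logCharacteristic_nonneg _ _) h6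
      _ ≤ _ := by gcongr; exact le_max_right _ _

/-! ### The shift quotient -/

lemma characteristic_add_one_le {g : ℂ → ℂ} {r h : ℝ} (hr : 1 ≤ r) (hh : 0 ≤ h)
    (hE : logCharacteristic g (r + h) - logCharacteristic g r ≤ Real.log 2) :
    ValueDistribution.characteristic g ⊤ (r + h) + 1 ≤
      2 * (ValueDistribution.characteristic g ⊤ r + 1) := by
  have h1 := ValueDistribution.characteristic_nonneg (f := g) (a := ⊤) hr
  have h2 := ValueDistribution.characteristic_nonneg (f := g) (a := ⊤)
    (show 1 ≤ r + h by linarith)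
  rw [logCharacteristic, logCharacteristic, max_eq_left hr, max_eq_left (by linarith)] at hE
  rw [← Real.log_le_log_iff (by linarith) (by linarith),
    Real.log_mul (by norm_num) (by linarith)]
  linarith

/-- Both summands are O(r^(ς + β - 1 + ε)), so the stated exponent is met with a factor r^β to
spare. -/
lemma div_rpow_add_div_rpow_mul_le {ς β ε r w : ℝ} (hβ : 0 < β) (hς : 0 ≤ ς) (hε : 0 < ε)
    (hε1 : ε < 1 - ς - 2 * β) (hr : 1 ≤ r) (hw : 0 < w) (hwr : w < r ^ β) :
    w / r ^ (1 - (ς + ε / 2)) + (w / r) ^ (1 - ε / 2) *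
      ((r + r ^ (1 - (ς + ε / 2))) / r ^ (1 - (ς + ε / 2))) ≤ 3 / r ^ (1 - ς - 2 * β - ε) := by
  have hr0 : 0 < r := by linarith
  set h : ℝ := r ^ (1 - (ς + ε / 2)) with hh
  have hh0 : 0 < h := by positivity
  have hhr : h ≤ r := by
    calc h ≤ r ^ (1 : ℝ) := Real.rpow_le_rpow_of_exponent_le hr (by linarith)
      _ = r := Real.rpow_one r
  have e1 : w / h ≤ r ^ (-(1 - ς - 2 * β - ε)) := by
    calc w / h ≤ r ^ β / h := by gcongr
      _ = r ^ (β - (1 - (ς + ε / 2))) := (Real.rpow_sub hr0 _ _).symm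
      _ ≤ _ := Real.rpow_le_rpow_of_exponent_le hr (by linarith)
  have e2 : (w / r) ^ (1 - ε / 2) ≤ r ^ ((β - 1) * (1 - ε / 2)) := by
    rw [Real.rpow_mul hr0.le, Real.rpow_sub_one hr0.ne']
    apply Real.rpow_le_rpow (by positivity) (by gcongr) (by linarith)
  have e3 : (r + h) / h ≤ 2 * r ^ (ς + ε / 2) := by
    rw [div_le_iff₀ hh0, mul_assoc, hh, ← Real.rpow_add hr0]
    simp only [add_sub_cancel, Real.rpow_one]
    linarith
  have e4 : (w / r) ^ (1 - ε / 2) * ((r + h) / h) ≤ 2 * r ^ (-(1 - ς - 2 * β - ε)) := by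
    calc _ ≤ r ^ ((β - 1) * (1 - ε / 2)) * (2 * r ^ (ς + ε / 2)) := by gcongr
      _ = 2 * r ^ ((β - 1) * (1 - ε / 2) + (ς + ε / 2)) := by
          rw [Real.rpow_add hr0 ((β - 1) * (1 - ε / 2))]; ring
      _ ≤ _ := by
          gcongr
          nlinarith
  rw [Real.rpow_neg hr0.le] at e1 e4
  rw [div_eq_mul_inv 3]
  linarith

/-- The parameters are s = ς + ε/4, σ = ς + ε/2 and α = 1 - ε/2. The exceptional set consists of the
r ≥ 1 at which log(T + 1) jumps by more than log 2 over a step r^(1-σ); it depends neither on ω nor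
on a. -/
lemma exists_exceptionalSet {f : ℂ → ℂ} (hf : Meromorphic f) (hconst : ¬ VarShift.IsConst f)
    {ς β : ℝ} (hς : VarShift.hyperOrder f = (ς : EReal)) (hβ : 0 < β) {ω : ℝ → ℂ}
    (hω : ∀ r : ℝ, 0 < r → 0 < ‖ω r‖ ∧ ‖ω r‖ < r ^ β) {a : ℂ}
    (ha : ¬ deriv f =ᶠ[codiscrete ℂ] fun _ ↦ a) {ε : ℝ} (hε : 0 < ε)
    (hε1 : ε < 1 - ς - 2 * β) : ∃ E : Set ℝ, VarShift.FiniteLogMeasure E ∧ ∃ K : ℝ, 0 < K ∧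
      ∀ᶠ r in VarShift.atTopOutside E,
        ValueDistribution.proximity (VarShift.shiftQuotient f a (ω r)) ⊤ r ≤
          K * (ValueDistribution.characteristic (deriv f) ⊤ r / r ^ (1 - ς - 2 * β - ε) +
            Real.log r) := by
  have hς0 := hyperOrder_nonneg hς
  have hf0 : ¬ f =ᶠ[codiscrete ℂ] 0 := fun h ↦ hconst ⟨0, h⟩
  have hg0 : ∀ z, meromorphicOrderAt (fun z ↦ deriv f z - a) z ≠ ⊤ :=
    meromorphicOrderAt_ne_top (hf.deriv.sub (Meromorphic.const a)) fun h0 ↦ ha (by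
      filter_upwards [h0] with z h
      exact sub_eq_zero.1 h)
  obtain ⟨C, hC⟩ := exists_logCharacteristic_deriv_le hf hf0 hς
    (show ς < ς + ε / 4 by linarith)
  obtain ⟨K, hK, hbd⟩ := exists_proximity_shiftQuotient_le_characteristic hf hg0
    (show 0 < 1 - ε / 2 by linarith) (by linarith)
  refine ⟨_, finiteLogMeasure_of_monotone (monotone_logCharacteristic hf.deriv)
    (logCharacteristic_nonneg _) (show 0 ≤ ς + ε / 4 by linarith)
    (show ς + ε / 4 < ς + ε / 2 by linarith) (by linarith) (Real.log_pos one_lt_two) hC,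
    1 + β + 6 * K, by positivity, ?_⟩
  rw [VarShift.atTopOutside, eventually_inf_principal]
  -- Since β < 1 - σ, the shift is eventually at most an eighth of the step h.
  have hlim : ∀ᶠ r : ℝ in atTop, 8 ≤ r ^ (1 - (ς + ε / 2) - β) :=
    (tendsto_rpow_atTop (by linarith)).eventually_ge_atTop 8
  filter_upwards [eventually_ge_atTop 4, hlim] with r hr4 hr8 hrE
  have hr1 : 1 ≤ r := by linarith
  have hr0 : 0 < r := by linarith
  set h : ℝ := r ^ (1 - (ς + ε / 2)) with hh
  have hh0 : 0 < h := by positivity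
  obtain ⟨hw0, hwβ⟩ := hω r hr0
  have hwh : 8 * ‖ω r‖ ≤ h := by
    rw [Real.rpow_sub hr0, ← hh, le_div_iff₀ (by positivity)] at hr8
    linarith
  have hE : logCharacteristic (deriv f) (r + h) - logCharacteristic (deriv f) r ≤ Real.log 2 := by
    by_contra! hn
    exact hrE ⟨hn, hr1⟩
  have hT := characteristic_add_one_le hr1 hh0.le hE
  set T : ℝ := ValueDistribution.characteristic (deriv f) ⊤ r with hTdef
  have hT0 : 0 ≤ T := ValueDistribution.characteristic_nonneg hr1
  have hlog4 : Real.log 4 ≤ Real.log r := Real.log_le_log (by norm_num) hr4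
  have hlog1 : 1 ≤ Real.log r := by
    refine le_trans ?_ hlog4
    rw [show (4 : ℝ) = 2 ^ 2 by norm_num, Real.log_pow]
    have := Real.log_two_gt_d9
    push_cast
    linarith
  have hexp := div_rpow_add_div_rpow_mul_le hβ hς0 hε hε1 hr1 hw0 hwβ
  have hpos : Real.posLog (4 * ‖ω r‖) ≤ (1 + β) * Real.log r := by
    have h1 : 1 ≤ r ^ β := Real.one_le_rpow hr1 hβ.le
    calc _ ≤ Real.posLog (4 * r ^ β) :=
          Real.posLog_le_posLog (by positivity) (by linarith)
      _ = Real.log 4 + β * Real.log r := by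
          rw [Real.posLog_eq_log (by rw [abs_of_pos (by positivity)]; linarith),
            Real.log_mul (by norm_num) (by positivity), Real.log_rpow hr0]
      _ ≤ _ := by linarith
  set Y : ℝ := r ^ (1 - ς - 2 * β - ε) with hY
  have hY1 : 1 ≤ Y := Real.one_le_rpow hr1 (by linarith)
  -- The additive 1 in T + 1 goes into the logarithmic error term.
  have h1Y : 1 / Y ≤ Real.log r := ((div_le_one (by linarith)).2 hY1).trans hlog1
  calc _ ≤ _ := hbd r h (ω r) hr1 hh0 (norm_pos_iff.1 hw0) hwh
    _ ≤ (1 + β) * Real.log r + K * (3 / Y) * (2 * (T + 1)) :=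
        add_le_add hpos (mul_le_mul (mul_le_mul_of_nonneg_left hexp hK.le) hT
          (add_nonneg (ValueDistribution.characteristic_nonneg (by linarith)) zero_le_one)
          (by positivity))
    _ = (1 + β) * Real.log r + 6 * K * (T / Y + 1 / Y) := by ring
    _ ≤ (1 + β) * Real.log r + 6 * K * (T / Y + Real.log r) := by gcongr
    _ ≤ _ := by
        have : 0 ≤ (1 + β) * (T / Y) := by positivity
        linarith

/-! ### Sign of the angular terms and the main theorem -/

lemma poleMult_nonneg (g : ℂ → ℂ) (z : ℂ) : (0 : ℝ) ≤ VarShift.poleMult g z := by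
  rw [VarShift.poleMult, Function.locallyFinsuppWithin.negPart_apply]
  exact_mod_cast negPart_nonneg _

lemma angularRatio_mul_nonneg (ε : ℝ) (w : ℂ) {r : ℝ} (hr : 1 ≤ r) (g : ℂ → ℂ) (s : ℝ) :
    0 ≤ VarShift.angularRatio ε w r g * (VarShift.N r g / r ^ s) := by
  have h : ∀ A : Set ℂ, 0 ≤ ∑ᶠ z ∈ A, (VarShift.poleMult g z : ℝ) := fun A ↦
    finsum_nonneg fun z ↦ finsum_nonneg fun _ ↦ poleMult_nonneg g z
  have h1 := ValueDistribution.logCounting_nonneg (f := g) (e := ⊤) hr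
  exact mul_nonneg (div_nonneg (h _) (h _)) (div_nonneg h1 (by positivity))

end Nevanlinna

end

end

theorem theorem1p2 (f : ℂ → ℂ) (hf : Meromorphic f) (hconst : ¬ VarShift.IsConst f)
    (ς β : ℝ) (hς : VarShift.hyperOrder f = (ς : EReal)) (hς_lt : ς < 3 / 4)
    (hβ_pos : 0 < β) (hβ_lt : β < min (1 / 2 - 1 / 2 * ς) (1 - 4 / 3 * ς))
    (ω : ℝ → ℂ) (hω : ∀ r : ℝ, 0 < r → 0 < ‖ω r‖ ∧ ‖ω r‖ < r ^ β)
    (a : ℂ) (ha : ¬ deriv f =ᶠ[Filter.codiscrete ℂ] fun _ => a) :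
    ∃ ε₀ : ℝ, 0 < ε₀ ∧ ∀ ε : ℝ, 0 < ε → ε < ε₀ →
      ∃ E : Set ℝ, VarShift.FiniteLogMeasure E ∧
        (fun r : ℝ => VarShift.m r (VarShift.shiftQuotient f a (ω r)))
          =O[VarShift.atTopOutside E]
          (fun r : ℝ =>
            VarShift.T r (deriv f) / r ^ (1 - ς - 2 * β - ε)
            + (VarShift.angularRatio ε (ω r) r (fun z => 1 / (deriv f z - a))
                  * (VarShift.N r (fun z => 1 / (deriv f z - a))
                      / r ^ (3 / 2 - 2 * ς - 3 / 2 * β - ε))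
              + VarShift.angularRatio ε (ω r) r (deriv f)
                  * (VarShift.N r (deriv f) / r ^ (3 / 2 - 2 * ς - 3 / 2 * β - ε)))
            + Real.log r) ∧
        (VarShift.IsTranscendental f →
          (fun r : ℝ => VarShift.m r (VarShift.shiftQuotient f a (ω r)))
            =o[VarShift.atTopOutside E] (fun r : ℝ => VarShift.T r (deriv f))) := by
  have hβ1 := hβ_lt.trans_le (min_le_left _ _)
  -- Positive because β < (1 - ς)/2. Taking ε below it keeps the exponent 1 - ς - 2β - ε positive,
  -- which the exceptional set and the little-o bound both need.
  refine ⟨1 - ς - 2 * β, by linarith, fun ε hε hε1 ↦ ?_⟩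
  obtain ⟨E, hE, K, hK, hbd⟩ := Nevanlinna.exists_exceptionalSet hf hconst hς hβ_pos hω ha hε hε1
  have hle : VarShift.atTopOutside E ≤ atTop := inf_le_left
  refine ⟨E, hE, ?_, fun htr ↦ ?_⟩
  · refine Asymptotics.IsBigO.of_bound K ?_
    filter_upwards [hbd, hle (eventually_ge_atTop 1)] with r h1 hr
    rw [Real.norm_of_nonneg (ValueDistribution.proximity_nonneg r)]
    refine h1.trans (mul_le_mul_of_nonneg_left ?_ hK.le)
    refine le_trans ?_ (Real.le_norm_self _)
    have h2 := Nevanlinna.angularRatio_mul_nonneg ε (ω r) hr (fun z => 1 / (deriv f z - a))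
      (3 / 2 - 2 * ς - 3 / 2 * β - ε)
    have h3 := Nevanlinna.angularRatio_mul_nonneg ε (ω r) hr (deriv f)
      (3 / 2 - 2 * ς - 3 / 2 * β - ε)
    linarith
  · refine Asymptotics.IsLittleO.of_bound fun c hc ↦ ?_
    -- Each half of c pays for one term: the power of r tends to infinity for the first, and T(r,f')
    -- outgrows every multiple of log r for the second.
    have hlim : ∀ᶠ r : ℝ in atTop, 2 * K / c ≤ r ^ (1 - ς - 2 * β - ε) :=
      (tendsto_rpow_atTop (by linarith)).eventually_ge_atTop _
    filter_upwards [hbd, hle (eventually_ge_atTop 1), hle hlim,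
      hle (Nevanlinna.eventually_lt_characteristic_deriv hf htr ha (2 * K / c))]
      with r h1 hr h2 h3
    have hT0 : 0 ≤ VarShift.T r (deriv f) := ValueDistribution.characteristic_nonneg hr
    rw [Real.norm_of_nonneg (ValueDistribution.proximity_nonneg r), Real.norm_of_nonneg hT0]
    have h4 : K * (VarShift.T r (deriv f) / r ^ (1 - ς - 2 * β - ε)) ≤
        c / 2 * VarShift.T r (deriv f) := by
      rw [div_le_iff₀ hc] at h2
      rw [← mul_div_assoc, div_le_iff₀ (by positivity)]
      nlinarith
    have h5 : K * Real.log r ≤ c / 2 * VarShift.T r (deriv f) := by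
      rw [div_mul_eq_mul_div, div_lt_iff₀ hc] at h3
      linarith
    linarith
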